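/- Let $n\ge 1$ be an integer, $q\in(0,n]$, and let $\mu$ be a nonzero finite Borel measure on the unit sphere $S^{n-1}\subset\mathbb R^n$, with total mass $|\mu|=\mu(S^{n-1})$. Let $\mathcal K^n_e$ be the class of origin-symmetric convex bodies in $\mathbb R^n$, i.e. compact convex sets $Q=-Q$ with nonempty interior; for $Q\in\mathcal K^n_e$ let $h_Q(u)=\max\{u\cdot y: y\in Q\}$ and $\rho_Q(u)=\max\{\lambda:\lambda u\in Q\}$, $u\in S^{n-1}$, be its support and radial functions. Define $\Phi:\mathcal K^n_e\to\mathbb R$ by $$\Phi(Q)=\frac1{|\mu|}\int_{S^{n-1}}\log\rho_Q(u)\,d\mu(u)+\frac1q\log\int_{S^{n-1}}h_Q(u)^{-q}\,du,$$ where $du$ is spherical Lebesgue measure. Suppose that $\mu$ satisfies the $q$-th subspace mass inequality, that is, for every ordered orthonormal basis $e_1,\dots,e_n$ of $\mathbb R^n$, with $\xi_{n-i}=\operatorname{span}\{e_{i+1},\dots,e_n\}$: - if $q\ge1$, then $\displaystyle\frac{\mu(S^{n-1}\cap\xi_{n-i})}{|\mu|}<1-\frac{i}{n-1}\Bigl(1-\frac1q\Bigr)$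 for every integer $i$ with $1\le i<n$; - if $q<1$, then $\displaystyle\frac{\mu(S^{n-1}\cap\xi_{n-1})}{|\mu|}<1$. Then there exists $K\in\mathcal K^n_e$ such that $$\sup_{Q\in\mathcal K^n_e}\Phi(Q)=\Phi(K);$$ in particular, the supremum is finite. -/

import Mathlib

open MeasureTheory
open scoped RealInnerProductSpace

noncomputable section

/-- The support function `h_Q(x) = max {x · y : y ∈ Q}`. -/
def supportFn {n : ℕ} (Q : Set (EuclideanSpace ℝ (Fin n))) (x : EuclideanSpace ℝ (Fin n)) : ℝ :=
  sSup ((fun y => ⟪x, y⟫) '' Q)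

/-- The radial function `ρ_Q(x) = max {t : t x ∈ Q}` (used only for `x ≠ 0`). -/
def radialFn {n : ℕ} (Q : Set (EuclideanSpace ℝ (Fin n))) (x : EuclideanSpace ℝ (Fin n)) : ℝ :=
  sSup {t : ℝ | t • x ∈ Q}

/-- The class of origin-symmetric convex bodies in `ℝⁿ`: compact convex sets with non-empty
interior that are invariant under `x ↦ -x`. Mathlib's `ConvexBody` is only required to be
non-empty, so that the non-empty interior has to be added. -/
def symmConvexBodies (n : ℕ) : Set (ConvexBody (EuclideanSpace ℝ (Fin n))) :=
  {Q | (interior (Q : Set (EuclideanSpace ℝ (Fin n)))).Nonempty ∧ ∀ x ∈ Q, -x ∈ Q}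

/-- The functional
`Φ(Q) = (1/|μ|) ∫ log ρ_Q dμ + (1/q) log ∫ h_Q(u)^{-q} du` over the unit sphere, where `du` is
the spherical Lebesgue measure (of total mass `n ωₙ`). -/
def dualMinkowskiFunctional {n : ℕ} (q : ℝ)
    (μ : Measure (Metric.sphere (0 : EuclideanSpace ℝ (Fin n)) 1))
    (Q : ConvexBody (EuclideanSpace ℝ (Fin n))) : ℝ :=
  1 / μ.real Set.univ * ∫ u, Real.log (radialFn (Q : Set (EuclideanSpace ℝ (Fin n))) u) ∂μ
    + 1 / q * Real.log (∫ u, supportFn (Q : Set (EuclideanSpace ℝ (Fin n))) u ^ (-q)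
        ∂(volume : Measure (EuclideanSpace ℝ (Fin n))).toSphere)

/-- For an ordered orthonormal basis `e₁, …, eₙ`, the subspace `span {e_{i+1}, …, eₙ}` of dimension
`n - i`. (The basis is indexed by `0, …, n - 1` in the code, so `e_{i+1}` is `e i`.) -/
def tailSpan {n : ℕ} (e : OrthonormalBasis (Fin n) ℝ (EuclideanSpace ℝ (Fin n))) (i : ℕ) :
    Submodule ℝ (EuclideanSpace ℝ (Fin n)) :=
  Submodule.span ℝ (e '' {j | i ≤ (j : ℕ)})

/-- The proportion `μ(S^{n-1} ∩ ξ) / |μ|` of the mass of `μ` that lies in the subspace `ξ`. -/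
def massRatio {n : ℕ} (μ : Measure (Metric.sphere (0 : EuclideanSpace ℝ (Fin n)) 1))
    (ξ : Submodule ℝ (EuclideanSpace ℝ (Fin n))) : ℝ :=
  μ.real {u | (u : EuclideanSpace ℝ (Fin n)) ∈ ξ} / μ.real Set.univ

/-- The `q`-th subspace mass inequality with respect to an ordered orthonormal basis. The reciprocal
`1 / q'` of the Hölder conjugate of `q` is written as `1 - 1 / q`, which is `0` for `q = 1`
(where `q' = ∞`). -/
def SubspaceMassIneqWrt {n : ℕ} (q : ℝ)
    (μ : Measure (Metric.sphere (0 : EuclideanSpace ℝ (Fin n)) 1))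
    (e : OrthonormalBasis (Fin n) ℝ (EuclideanSpace ℝ (Fin n))) : Prop :=
  (1 ≤ q → ∀ i : ℕ, 1 ≤ i → i < n →
    massRatio μ (tailSpan e i) < 1 - (i : ℝ) / ((n : ℝ) - 1) * (1 - 1 / q)) ∧
  (q < 1 → massRatio μ (tailSpan e 1) < 1)

/-- The `q`-th subspace mass inequality: it holds with respect to every orthonormal basis. -/
def SubspaceMassIneq {n : ℕ} (q : ℝ)
    (μ : Measure (Metric.sphere (0 : EuclideanSpace ℝ (Fin n)) 1)) : Prop :=
  ∀ e : OrthonormalBasis (Fin n) ℝ (EuclideanSpace ℝ (Fin n)), SubspaceMassIneqWrt q μ e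

end

open Filter Topology Pointwise

variable {n : ℕ}

/-! The functional is invariant under dilations and continuous on bodies squeezed between two fixed
balls, and such bodies form a compact set in the Hausdorff metric. So it is enough to show that a
body whose value is at least that of the unit ball has bounded eccentricity.

Replace a body by an orthogonal box with axes `a₀ ≤ … ≤ aₙ₋₁` along an orthonormal basis `e`, at the
cost of factors `√n` (`IsSymmBody.exists_box`). For weights `θᵢ ≥ 0` with sum `1` and `q θᵢ < 1` for
`i ≠ 0`, the support term is at most `const - ∑ θᵢ log aᵢ` (`exists_integral_supportFn_le`). The
condition on `θᵢ` is integrability of `|t| ^ (-q θᵢ)` at `0`; `θ₀` needs none, since `h` is bounded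
below by a multiple of the shortest axis everywhere on the sphere.

If the first coordinate of `u` that is not small has index `k`, then `ρ(u)` is at most a multiple of
`a_k`. Averaging, the radial term is at most `const + log a₀ + ∑ mᵢ (log aᵢ - log aᵢ₋₁)`, where `mᵢ`
is the mass proportion of vectors whose first `i` coordinates are small, hence close to that of the
tail subspace. Summation by parts writes `∑ θᵢ log aᵢ` as `log a₀ + ∑ Wᵢ (log aᵢ - log aᵢ₋₁)` with
tail sums `Wᵢ = ∑_{j ≥ i} θⱼ`. The mass inequality is what allows weights with `mᵢ < Wᵢ`
(`exists_weights`), and then the functional is at most `C - ε log (aₙ₋₁ / a₀)`.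

The constants can be kept the same for nearby bases, and compactness of the set of orthonormal
frames makes them uniform (`hasUniformBound_orthonormal`). -/

/-- A compact convex set, symmetric about the origin, with the origin in its interior. -/
structure IsSymmBody (Q : Set (EuclideanSpace ℝ (Fin n))) : Prop where
  isCompact : IsCompact Q
  convex : Convex ℝ Q
  neg_mem : ∀ x ∈ Q, -x ∈ Q
  mem_nhds : Q ∈ 𝓝 (0 : EuclideanSpace ℝ (Fin n))

/-! ### Radial and support functions of a symmetric body. -/

namespace IsSymmBody

variable {Q Q' : Set (EuclideanSpace ℝ (Fin n))}

theorem of_mem_symmConvexBodies {K : ConvexBody (EuclideanSpace ℝ (Fin n))}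
    (hK : K ∈ symmConvexBodies n) : IsSymmBody (K : Set (EuclideanSpace ℝ (Fin n))) := by
  refine ⟨K.isCompact, K.convex, hK.2, ?_⟩
  obtain ⟨x, hx⟩ := hK.1
  have hx' : -x ∈ (K : Set (EuclideanSpace ℝ (Fin n))) := hK.2 x (interior_subset hx)
  have := K.convex.combo_interior_self_mem_interior hx hx' (a := 1 / 2) (b := 1 / 2)
    (by norm_num) (by norm_num) (by norm_num)
  rw [smul_neg, add_neg_cancel] at this
  exact mem_interior_iff_mem_nhds.1 this

theorem exists_convexBody (hQ : IsSymmBody Q) :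
    ∃ K ∈ symmConvexBodies n, (K : Set (EuclideanSpace ℝ (Fin n))) = Q :=
  ⟨⟨Q, hQ.convex, hQ.isCompact, ⟨0, mem_of_mem_nhds hQ.mem_nhds⟩⟩,
    ⟨⟨0, mem_interior_iff_mem_nhds.2 hQ.mem_nhds⟩, hQ.neg_mem⟩, rfl⟩

theorem zero_mem (hQ : IsSymmBody Q) : (0 : EuclideanSpace ℝ (Fin n)) ∈ Q :=
  mem_of_mem_nhds hQ.mem_nhds

theorem absorbent (hQ : IsSymmBody Q) : Absorbent ℝ Q := absorbent_nhds_zero hQ.mem_nhds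

theorem gauge_pos (hQ : IsSymmBody Q) {x : EuclideanSpace ℝ (Fin n)} (hx : x ≠ 0) :
    0 < gauge Q x :=
  (_root_.gauge_pos hQ.absorbent
    ((NormedSpace.isVonNBounded_iff ℝ).2 hQ.isCompact.isBounded)).2 hx

theorem mem_iff_gauge_le_one (hQ : IsSymmBody Q) {x : EuclideanSpace ℝ (Fin n)} :
    x ∈ Q ↔ gauge Q x ≤ 1 := by
  rw [gauge_le_one_iff_mem_closure hQ.convex hQ.mem_nhds, hQ.isCompact.isClosed.closure_eq]

theorem isGreatest_inv_gauge (hQ : IsSymmBody Q) {x : EuclideanSpace ℝ (Fin n)} (hx : x ≠ 0) :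
    IsGreatest {t : ℝ | t • x ∈ Q} (gauge Q x)⁻¹ := by
  have hg := hQ.gauge_pos hx
  constructor
  · rw [Set.mem_ofPred_eq, hQ.mem_iff_gauge_le_one, gauge_smul_of_nonneg (by positivity)]
    simp [hg.ne']
  · intro t ht
    rcases le_or_gt t 0 with h | h
    · exact h.trans (by positivity)
    · rw [Set.mem_ofPred_eq, hQ.mem_iff_gauge_le_one, gauge_smul_of_nonneg h.le, smul_eq_mul] at ht
      rwa [le_inv_comm₀ h hg, ← one_div, le_div_iff₀ h, mul_comm]

/-- The gauge is known to be continuous and positive off the origin; this identity transfers both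
facts to the radial function. -/
theorem radialFn_eq (hQ : IsSymmBody Q) {x : EuclideanSpace ℝ (Fin n)} (hx : x ≠ 0) :
    radialFn Q x = (gauge Q x)⁻¹ :=
  (hQ.isGreatest_inv_gauge hx).csSup_eq

theorem radialFn_pos (hQ : IsSymmBody Q) {x : EuclideanSpace ℝ (Fin n)} (hx : x ≠ 0) :
    0 < radialFn Q x := by
  rw [hQ.radialFn_eq hx]; exact inv_pos.2 (hQ.gauge_pos hx)

theorem radialFn_smul_mem (hQ : IsSymmBody Q) {x : EuclideanSpace ℝ (Fin n)} (hx : x ≠ 0) :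
    radialFn Q x • x ∈ Q := by
  rw [hQ.radialFn_eq hx]; exact (hQ.isGreatest_inv_gauge hx).1

theorem le_radialFn (hQ : IsSymmBody Q) {x : EuclideanSpace ℝ (Fin n)} (hx : x ≠ 0) {t : ℝ}
    (ht : t • x ∈ Q) : t ≤ radialFn Q x := by
  rw [hQ.radialFn_eq hx]; exact (hQ.isGreatest_inv_gauge hx).2 ht

theorem continuous_log_radialFn (hQ : IsSymmBody Q) :
    Continuous fun u : Metric.sphere (0 : EuclideanSpace ℝ (Fin n)) 1 =>
      Real.log (radialFn Q u) := by
  have h0 : ∀ u : Metric.sphere (0 : EuclideanSpace ℝ (Fin n)) 1,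
      (u : EuclideanSpace ℝ (Fin n)) ≠ 0 := fun u => ne_zero_of_mem_unit_sphere u
  refine Continuous.log ?_ fun u => (hQ.radialFn_pos (h0 u)).ne'
  have : (fun u : Metric.sphere (0 : EuclideanSpace ℝ (Fin n)) 1 => radialFn Q u) =
      fun u : Metric.sphere (0 : EuclideanSpace ℝ (Fin n)) 1 =>
        (gauge Q (u : EuclideanSpace ℝ (Fin n)))⁻¹ := by
    funext u; exact hQ.radialFn_eq (h0 u)
  rw [this]
  exact ((continuous_gauge hQ.convex hQ.mem_nhds).comp continuous_subtype_val).inv₀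
    fun u => (hQ.gauge_pos (h0 u)).ne'

theorem integrable_log_radialFn (hQ : IsSymmBody Q)
    (μ : Measure (Metric.sphere (0 : EuclideanSpace ℝ (Fin n)) 1)) [IsFiniteMeasure μ] :
    Integrable (fun u : Metric.sphere (0 : EuclideanSpace ℝ (Fin n)) 1 =>
      Real.log (radialFn Q u)) μ :=
  hQ.continuous_log_radialFn.integrable_of_hasCompactSupport (HasCompactSupport.of_compactSpace _)

theorem bddAbove_inner (hQ : IsSymmBody Q) (x : EuclideanSpace ℝ (Fin n)) :
    BddAbove ((fun y => ⟪x, y⟫) '' Q) :=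
  (hQ.isCompact.image (by fun_prop)).bddAbove

theorem inner_le_supportFn (hQ : IsSymmBody Q) {x y : EuclideanSpace ℝ (Fin n)} (hy : y ∈ Q) :
    ⟪x, y⟫ ≤ supportFn Q x :=
  le_csSup (hQ.bddAbove_inner x) ⟨y, hy, rfl⟩

theorem abs_inner_le_supportFn (hQ : IsSymmBody Q) {x y : EuclideanSpace ℝ (Fin n)}
    (hy : y ∈ Q) : |⟪x, y⟫| ≤ supportFn Q x := by
  refine abs_le'.2 ⟨hQ.inner_le_supportFn hy, ?_⟩
  rw [← inner_neg_right]
  exact hQ.inner_le_supportFn (hQ.neg_mem y hy)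

theorem exists_supportFn_eq (hQ : IsSymmBody Q) (x : EuclideanSpace ℝ (Fin n)) :
    ∃ y ∈ Q, supportFn Q x = ⟪x, y⟫ := by
  obtain ⟨y, hy, h⟩ := (hQ.isCompact.image (f := fun y => ⟪x, y⟫) (by fun_prop)).sSup_mem
    (Set.Nonempty.image _ ⟨0, hQ.zero_mem⟩)
  exact ⟨y, hy, h.symm⟩

theorem supportFn_pos (hQ : IsSymmBody Q) {x : EuclideanSpace ℝ (Fin n)} (hx : x ≠ 0) :
    0 < supportFn Q x := by
  have h := hQ.inner_le_supportFn (x := x) (hQ.radialFn_smul_mem hx)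
  rw [inner_smul_right, real_inner_self_eq_norm_sq] at h
  have := hQ.radialFn_pos hx
  have := norm_pos_iff.2 hx
  exact lt_of_lt_of_le (by positivity) h

theorem continuous_supportFn (hQ : IsSymmBody Q) : Continuous (supportFn Q) :=
  hQ.isCompact.continuous_sSup (f := fun x y => ⟪x, y⟫) (by fun_prop)

theorem continuous_supportFn_rpow (hQ : IsSymmBody Q) (r : ℝ) :
    Continuous fun u : Metric.sphere (0 : EuclideanSpace ℝ (Fin n)) 1 => supportFn Q u ^ r :=
  (hQ.continuous_supportFn.comp continuous_subtype_val).rpow_const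
    fun u => Or.inl (hQ.supportFn_pos (ne_zero_of_mem_unit_sphere u)).ne'

theorem integrable_supportFn_rpow (hQ : IsSymmBody Q) (r : ℝ)
    (σ : Measure (Metric.sphere (0 : EuclideanSpace ℝ (Fin n)) 1)) [IsFiniteMeasure σ] :
    Integrable (fun u : Metric.sphere (0 : EuclideanSpace ℝ (Fin n)) 1 => supportFn Q u ^ r) σ :=
  (hQ.continuous_supportFn_rpow r).integrable_of_hasCompactSupport
    (HasCompactSupport.of_compactSpace _)

theorem integral_supportFn_rpow_pos (hn : n ≠ 0) (hQ : IsSymmBody Q) (r : ℝ) :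
    0 < ∫ u, supportFn Q u ^ r ∂(volume : Measure (EuclideanSpace ℝ (Fin n))).toSphere := by
  have : Nonempty (Fin n) := ⟨⟨0, Nat.pos_of_ne_zero hn⟩⟩
  have hpos : ∀ u : Metric.sphere (0 : EuclideanSpace ℝ (Fin n)) 1, 0 < supportFn Q u ^ r :=
    fun u => Real.rpow_pos_of_pos (hQ.supportFn_pos (ne_zero_of_mem_unit_sphere u)) r
  rw [integral_pos_iff_support_of_nonneg (fun u => (hpos u).le)
    (hQ.integrable_supportFn_rpow r _)]
  have : Function.support (fun u : Metric.sphere (0 : EuclideanSpace ℝ (Fin n)) 1 =>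
      supportFn Q u ^ r) = Set.univ := by
    ext u; simpa using (hpos u).ne'
  rw [this]
  exact pos_iff_ne_zero.2 (mt Measure.measure_univ_eq_zero.1 (Measure.toSphere_ne_zero _))

theorem smul (hQ : IsSymmBody Q) {t : ℝ} (ht : 0 < t) : IsSymmBody (t • Q) := by
  refine ⟨hQ.isCompact.smul t, hQ.convex.smul t, ?_, ?_⟩
  · rintro _ ⟨x, hx, rfl⟩
    exact ⟨-x, hQ.neg_mem x hx, by simp⟩
  · exact (set_smul_mem_nhds_zero_iff ht.ne').2 hQ.mem_nhds

theorem closedBall {r : ℝ} (hr : 0 < r) :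
    IsSymmBody (Metric.closedBall (0 : EuclideanSpace ℝ (Fin n)) r) :=
  ⟨isCompact_closedBall _ _, convex_closedBall _ _, fun x hx => by simpa using hx,
    Metric.closedBall_mem_nhds _ hr⟩

end IsSymmBody

/-! ### Behaviour of the functional under inclusion and scaling. -/

/-- The functional `dualMinkowskiFunctional` on arbitrary sets. -/
noncomputable def setFunctional (q : ℝ) (μ : Measure (Metric.sphere (0 : EuclideanSpace ℝ (Fin n)) 1))
    (Q : Set (EuclideanSpace ℝ (Fin n))) : ℝ :=
  1 / μ.real Set.univ * ∫ u, Real.log (radialFn Q u) ∂μ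
    + 1 / q * Real.log (∫ u, supportFn Q u ^ (-q)
        ∂(volume : Measure (EuclideanSpace ℝ (Fin n))).toSphere)

theorem integral_log_radialFn_le {Q Q' : Set (EuclideanSpace ℝ (Fin n))} (hQ : IsSymmBody Q)
    (hQ' : IsSymmBody Q') {t : ℝ} (ht : 0 < t) (h : Q ⊆ t • Q')
    (μ : Measure (Metric.sphere (0 : EuclideanSpace ℝ (Fin n)) 1)) [IsFiniteMeasure μ]
    (hμ : μ ≠ 0) :
    1 / μ.real Set.univ * ∫ u, Real.log (radialFn Q u) ∂μ ≤
      1 / μ.real Set.univ * ∫ u, Real.log (radialFn Q' u) ∂μ + Real.log t := by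
  have hm : 0 < μ.real Set.univ := by
    simpa [measureReal_def, ENNReal.toReal_pos_iff, pos_iff_ne_zero] using hμ
  have key : ∫ u, Real.log (radialFn Q u) ∂μ ≤
      ∫ u, (Real.log (radialFn Q' u) + Real.log t) ∂μ := by
    refine integral_mono (hQ.integrable_log_radialFn μ)
      ((hQ'.integrable_log_radialFn μ).add (integrable_const _)) fun u => ?_
    have hu : (u : EuclideanSpace ℝ (Fin n)) ≠ 0 := ne_zero_of_mem_unit_sphere u
    have h1 := h (hQ.radialFn_smul_mem hu)
    rw [Set.mem_smul_set_iff_inv_smul_mem₀ ht.ne', smul_smul] at h1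
    have h2 := hQ'.le_radialFn hu h1
    rw [inv_mul_le_iff₀ ht] at h2
    dsimp only
    rw [add_comm, ← Real.log_mul ht.ne' (hQ'.radialFn_pos hu).ne']
    exact Real.log_le_log (hQ.radialFn_pos hu) h2
  rw [integral_add (hQ'.integrable_log_radialFn μ) (integrable_const _), integral_const,
    smul_eq_mul] at key
  calc _ ≤ 1 / μ.real Set.univ * _ := mul_le_mul_of_nonneg_left key (by positivity)
    _ = _ := by field_simp

theorem log_integral_supportFn_le (hn : n ≠ 0) {Q Q' : Set (EuclideanSpace ℝ (Fin n))}
    (hQ : IsSymmBody Q) (hQ' : IsSymmBody Q') {s : ℝ} (hs : 0 < s) (h : s • Q' ⊆ Q)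
    {q : ℝ} (hq : 0 < q) :
    1 / q * Real.log (∫ u, supportFn Q u ^ (-q)
        ∂(volume : Measure (EuclideanSpace ℝ (Fin n))).toSphere) ≤
      1 / q * Real.log (∫ u, supportFn Q' u ^ (-q)
        ∂(volume : Measure (EuclideanSpace ℝ (Fin n))).toSphere) - Real.log s := by
  have key : ∫ u, supportFn Q u ^ (-q) ∂(volume : Measure (EuclideanSpace ℝ (Fin n))).toSphere ≤
      s ^ (-q) * ∫ u, supportFn Q' u ^ (-q)
        ∂(volume : Measure (EuclideanSpace ℝ (Fin n))).toSphere := by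
    rw [← integral_const_mul]
    refine integral_mono (hQ.integrable_supportFn_rpow _ _)
      ((hQ'.integrable_supportFn_rpow _ _).const_mul _) fun u => ?_
    have hu : (u : EuclideanSpace ℝ (Fin n)) ≠ 0 := ne_zero_of_mem_unit_sphere u
    dsimp only
    rw [← Real.mul_rpow hs.le (hQ'.supportFn_pos hu).le]
    obtain ⟨y, hy, hy'⟩ := hQ'.exists_supportFn_eq (u : EuclideanSpace ℝ (Fin n))
    have h1 := hQ.inner_le_supportFn (x := (u : EuclideanSpace ℝ (Fin n)))
      (h (Set.smul_mem_smul_set hy))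
    rw [inner_smul_right, ← hy'] at h1
    exact Real.rpow_le_rpow_of_nonpos (mul_pos hs (hQ'.supportFn_pos hu)) h1 (by linarith)
  have h2 := Real.log_le_log (hQ.integral_supportFn_rpow_pos hn (-q)) key
  rw [Real.log_mul (Real.rpow_pos_of_pos hs _).ne'
    (hQ'.integral_supportFn_rpow_pos hn (-q)).ne', Real.log_rpow hs] at h2
  calc _ ≤ 1 / q * _ := mul_le_mul_of_nonneg_left h2 (by positivity)
    _ = _ := by field_simp; ring

/-- The outer inclusion controls only the radial term and the inner one only the support term.
Taking `s = t` gives dilation invariance, taking `s = t⁻¹` gives continuity. -/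
theorem setFunctional_le_add_log (hn : n ≠ 0) {Q Q' : Set (EuclideanSpace ℝ (Fin n))}
    (hQ : IsSymmBody Q) (hQ' : IsSymmBody Q') {s t : ℝ} (hs : 0 < s) (ht : 0 < t)
    (hsQ : s • Q' ⊆ Q) (htQ : Q ⊆ t • Q') {q : ℝ} (hq : 0 < q)
    (μ : Measure (Metric.sphere (0 : EuclideanSpace ℝ (Fin n)) 1)) [IsFiniteMeasure μ]
    (hμ : μ ≠ 0) :
    setFunctional q μ Q ≤ setFunctional q μ Q' + Real.log t - Real.log s := by
  have h1 := integral_log_radialFn_le hQ hQ' ht htQ μ hμ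
  have h2 := log_integral_supportFn_le hn hQ hQ' hs hsQ hq
  unfold setFunctional
  linarith

/-! ### Selection theorem and continuity in the Hausdorff metric. -/

/-- The compact sets that contain the ball of radius `r`, lie in the ball of radius `R`, and whose
distance function is even and convex. -/
def symmBodiesBetween (n : ℕ) (r R : ℝ) :
    Set (TopologicalSpace.NonemptyCompacts (EuclideanSpace ℝ (Fin n))) :=
  {L | (L : Set (EuclideanSpace ℝ (Fin n))) ⊆ Metric.closedBall 0 R} ∩
    ((⋂ x ∈ Metric.closedBall (0 : EuclideanSpace ℝ (Fin n)) r,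
        {L | Metric.infDist x (L : Set (EuclideanSpace ℝ (Fin n))) ≤ 0}) ∩
      ((⋂ x : EuclideanSpace ℝ (Fin n), {L | Metric.infDist (-x) (L : Set _) ≤
          Metric.infDist x (L : Set _)}) ∩
        ⋂ (x : EuclideanSpace ℝ (Fin n)) (y : EuclideanSpace ℝ (Fin n)) (a : ℝ) (b : ℝ)
          (_ : 0 ≤ a) (_ : 0 ≤ b) (_ : a + b = 1), {L | Metric.infDist (a • x + b • y) (L : Set _) ≤
            a * Metric.infDist x (L : Set _) + b * Metric.infDist y (L : Set _)}))

/-- The distance from a fixed point is a Lipschitz function of the set, so every condition phrased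
by distances is closed, while the compact subsets of a fixed ball form a compact space. -/
theorem isCompact_symmBodiesBetween (r R : ℝ) : IsCompact (symmBodiesBetween n r R) := by
  have hc : ∀ x : EuclideanSpace ℝ (Fin n), Continuous
      fun L : TopologicalSpace.NonemptyCompacts (EuclideanSpace ℝ (Fin n)) =>
        Metric.infDist x (L : Set (EuclideanSpace ℝ (Fin n))) :=
    fun x => (Metric.lipschitz_infDist_set x).continuous
  refine (TopologicalSpace.NonemptyCompacts.isCompact_subsets_of_isCompact
    (isCompact_closedBall 0 R)).inter_right (IsClosed.inter ?_ (IsClosed.inter ?_ ?_))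
  · exact isClosed_iInter fun x => isClosed_iInter fun _ => isClosed_le (hc x) continuous_const
  · exact isClosed_iInter fun x => isClosed_le (hc _) (hc x)
  · refine isClosed_iInter fun x => isClosed_iInter fun y => isClosed_iInter fun a =>
      isClosed_iInter fun b => isClosed_iInter fun _ => isClosed_iInter fun _ =>
      isClosed_iInter fun _ => isClosed_le (hc _) ?_
    exact (continuous_const.mul (hc x)).add (continuous_const.mul (hc y))

theorem mem_iff_infDist_nonpos (L : TopologicalSpace.NonemptyCompacts (EuclideanSpace ℝ (Fin n)))
    (x : EuclideanSpace ℝ (Fin n)) : x ∈ (L : Set (EuclideanSpace ℝ (Fin n))) ↔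
      Metric.infDist x (L : Set (EuclideanSpace ℝ (Fin n))) ≤ 0 := by
  rw [L.isCompact.isClosed.mem_iff_infDist_zero L.nonempty]
  exact ⟨fun h => h.le, fun h => le_antisymm h Metric.infDist_nonneg⟩

theorem mem_symmBodiesBetween_iff {r R : ℝ} (hr : 0 < r)
    {L : TopologicalSpace.NonemptyCompacts (EuclideanSpace ℝ (Fin n))} :
    L ∈ symmBodiesBetween n r R ↔ IsSymmBody (L : Set (EuclideanSpace ℝ (Fin n))) ∧
      Metric.closedBall 0 r ⊆ (L : Set (EuclideanSpace ℝ (Fin n))) ∧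
      (L : Set (EuclideanSpace ℝ (Fin n))) ⊆ Metric.closedBall 0 R := by
  simp only [symmBodiesBetween, Set.mem_inter_iff, Set.mem_iInter, Set.mem_ofPred_eq]
  constructor
  · rintro ⟨h1, h2, h3, h4⟩
    have hball : Metric.closedBall 0 r ⊆ (L : Set (EuclideanSpace ℝ (Fin n))) :=
      fun x hx => (mem_iff_infDist_nonpos L x).2 (h2 x hx)
    refine ⟨⟨L.isCompact, ?_, ?_, ?_⟩, hball, h1⟩
    · intro x hx y hy a b ha hb hab
      rw [mem_iff_infDist_nonpos] at hx hy ⊢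
      have := h4 x y a b ha hb hab
      nlinarith [mul_le_mul_of_nonneg_left hx ha, mul_le_mul_of_nonneg_left hy hb]
    · intro x hx
      rw [mem_iff_infDist_nonpos] at hx ⊢
      exact (h3 x).trans hx
    · exact mem_of_superset (Metric.closedBall_mem_nhds _ hr) hball
  · rintro ⟨h, hball, h1⟩
    refine ⟨h1, fun x hx => (mem_iff_infDist_nonpos L x).1 (hball hx), fun x => ?_, ?_⟩
    · obtain ⟨p, hp, hxp⟩ := L.isCompact.exists_infDist_eq_dist L.nonempty x
      rw [hxp, ← dist_neg_neg]
      exact Metric.infDist_le_dist_of_mem (h.neg_mem p hp)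
    · intro x y a b ha hb hab
      obtain ⟨p, hp, hxp⟩ := L.isCompact.exists_infDist_eq_dist L.nonempty x
      obtain ⟨p', hp', hyp⟩ := L.isCompact.exists_infDist_eq_dist L.nonempty y
      rw [hxp, hyp]
      refine (Metric.infDist_le_dist_of_mem (h.convex hp hp' ha hb hab)).trans ?_
      refine (dist_add_add_le _ _ _ _).trans (add_le_add ?_ ?_)
      · rw [dist_smul₀, Real.norm_of_nonneg ha]
      · rw [dist_smul₀, Real.norm_of_nonneg hb]

/-- A point `x` of `L` is `y + (x - y)` with `y ∈ M` and `‖x - y‖ < d`. The second summand lies in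
`(d / r) • M` because `M` contains the ball of radius `r`, and convexity adds the two factors. -/
theorem subset_smul_of_hausdorffDist_lt {r d : ℝ} (hr : 0 < r)
    {L M : TopologicalSpace.NonemptyCompacts (EuclideanSpace ℝ (Fin n))}
    (hM : IsSymmBody (M : Set (EuclideanSpace ℝ (Fin n))))
    (hball : Metric.closedBall 0 r ⊆ (M : Set (EuclideanSpace ℝ (Fin n)))) (hd : dist L M < d) :
    (L : Set (EuclideanSpace ℝ (Fin n))) ⊆ (1 + d / r) • (M : Set (EuclideanSpace ℝ (Fin n))) := by
  intro x hx
  have hd0 : 0 < d := dist_nonneg.trans_lt hd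
  obtain ⟨y, hy, hxy⟩ := Metric.exists_dist_lt_of_hausdorffDist_lt hx
    (by rwa [Metric.NonemptyCompacts.dist_eq] at hd)
    (Metric.hausdorffEDist_ne_top_of_nonempty_of_bounded L.nonempty M.nonempty
      L.isCompact.isBounded M.isCompact.isBounded)
  have hz : (r / d) • (x - y) ∈ (M : Set (EuclideanSpace ℝ (Fin n))) := by
    apply hball
    rw [mem_closedBall_zero_iff, norm_smul, Real.norm_of_nonneg (by positivity), ← dist_eq_norm]
    calc r / d * dist x y ≤ r / d * d := by gcongr
      _ = r := by field_simp
  have ht : 0 < 1 + d / r := by positivity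
  rw [Set.mem_smul_set_iff_inv_smul_mem₀ ht.ne']
  have := hM.convex hy hz (a := (1 + d / r)⁻¹) (b := (1 + d / r)⁻¹ * (d / r)) (by positivity)
    (by positivity) (by field_simp)
  convert this using 1
  rw [mul_smul, ← smul_add, smul_smul, show d / r * (r / d) = 1 by field_simp, one_smul,
    add_sub_cancel]

theorem continuousOn_setFunctional (hn : n ≠ 0) {r R : ℝ} (hr : 0 < r) {q : ℝ} (hq : 0 < q)
    (μ : Measure (Metric.sphere (0 : EuclideanSpace ℝ (Fin n)) 1)) [IsFiniteMeasure μ]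
    (hμ : μ ≠ 0) :
    ContinuousOn (fun L : TopologicalSpace.NonemptyCompacts (EuclideanSpace ℝ (Fin n)) =>
      setFunctional q μ (L : Set (EuclideanSpace ℝ (Fin n)))) (symmBodiesBetween n r R) := by
  have key : ∀ d > 0, ∀ L ∈ symmBodiesBetween n r R, ∀ M ∈ symmBodiesBetween n r R,
      dist L M < d → setFunctional q μ (L : Set (EuclideanSpace ℝ (Fin n))) ≤
        setFunctional q μ (M : Set (EuclideanSpace ℝ (Fin n))) + 2 * Real.log (1 + d / r) := by
    intro d hd L hL M hM hLM
    rw [mem_symmBodiesBetween_iff hr] at hL hM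
    have ht : 0 < 1 + d / r := by positivity
    have h1 := subset_smul_of_hausdorffDist_lt hr hM.1 hM.2.1 hLM
    have h2 := subset_smul_of_hausdorffDist_lt hr hL.1 hL.2.1 (dist_comm L M ▸ hLM)
    rw [Set.subset_smul_set_iff₀ ht.ne'] at h2
    have := setFunctional_le_add_log hn hL.1 hM.1 (inv_pos.2 ht) ht h2 h1 hq μ hμ
    rw [Real.log_inv] at this
    linarith
  rw [Metric.continuousOn_iff]
  intro M hM ε hε
  -- With this distance the error `2 log (1 + δ / r)` equals `ε / 2`.
  have hδ : 0 < r * (Real.exp (ε / 4) - 1) :=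
    mul_pos hr (by have := Real.add_one_lt_exp (x := ε / 4) (by positivity); linarith)
  refine ⟨_, hδ, fun L hL hLM => ?_⟩
  have h1 := key _ hδ L hL M hM hLM
  have h2 := key _ hδ M hM L hL (dist_comm L M ▸ hLM)
  rw [mul_div_cancel_left₀ _ hr.ne', add_sub_cancel, Real.log_exp] at h1 h2
  rw [Real.dist_eq, abs_lt]
  constructor <;> linarith

theorem exists_maximizer_between (hn : n ≠ 0) {r R : ℝ} (hr : 0 < r) (hrR : r ≤ R) {q : ℝ}
    (hq : 0 < q) (μ : Measure (Metric.sphere (0 : EuclideanSpace ℝ (Fin n)) 1))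
    [IsFiniteMeasure μ] (hμ : μ ≠ 0) :
    ∃ M : Set (EuclideanSpace ℝ (Fin n)), IsSymmBody M ∧ ∀ Q : Set (EuclideanSpace ℝ (Fin n)),
      IsSymmBody Q → Metric.closedBall 0 r ⊆ Q → Q ⊆ Metric.closedBall 0 R →
        setFunctional q μ Q ≤ setFunctional q μ M := by
  have hlift : ∀ Q : Set (EuclideanSpace ℝ (Fin n)), IsSymmBody Q → Metric.closedBall 0 r ⊆ Q →
      Q ⊆ Metric.closedBall 0 R → ∃ L ∈ symmBodiesBetween n r R, (L : Set _) = Q :=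
    fun Q hQ h1 h2 => ⟨⟨⟨Q, hQ.isCompact⟩, ⟨0, hQ.zero_mem⟩⟩,
      (mem_symmBodiesBetween_iff hr).2 ⟨hQ, h1, h2⟩, rfl⟩
  obtain ⟨B, hB, -⟩ := hlift _ (IsSymmBody.closedBall hr) le_rfl
    (Metric.closedBall_subset_closedBall hrR)
  obtain ⟨M, hM, hmax⟩ := (isCompact_symmBodiesBetween (n := n) r R).exists_isMaxOn ⟨B, hB⟩
    (continuousOn_setFunctional hn hr hq μ hμ)
  refine ⟨M, ((mem_symmBodiesBetween_iff hr).1 hM).1, fun Q hQ h1 h2 => ?_⟩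
  obtain ⟨L, hL, rfl⟩ := hlift Q hQ h1 h2
  exact hmax hL

/-! ### Approximation of a symmetric body by an orthogonal box. -/

/-- Every symmetric body contains a basis with respect to which all its points have coordinates
in `[-1, 1]` (a basis in the body of maximal determinant). -/
theorem IsSymmBody.exists_basis {Q : Set (EuclideanSpace ℝ (Fin n))} (hQ : IsSymmBody Q) :
    ∃ p : Module.Basis (Fin n) ℝ (EuclideanSpace ℝ (Fin n)),
      (∀ i, p i ∈ Q) ∧ ∀ x ∈ Q, ∀ i, |p.repr x i| ≤ 1 := by
  set b := (EuclideanSpace.basisFun (Fin n) ℝ).toBasis with hb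
  have hcont : Continuous fun p : Fin n → EuclideanSpace ℝ (Fin n) => |b.det p| := by
    simp only [Module.Basis.det_apply]
    refine (Continuous.matrix_det ?_).abs
    refine continuous_matrix fun i j => ?_
    simp only [hb, Module.Basis.toMatrix_apply, OrthonormalBasis.coe_toBasis_repr_apply,
      EuclideanSpace.basisFun_repr]
    fun_prop
  obtain ⟨p, hp, hmax⟩ := (isCompact_univ_pi fun _ : Fin n => hQ.isCompact).exists_isMaxOn
    ⟨fun _ => 0, fun _ _ => hQ.zero_mem⟩ hcont.continuousOn
  have hpos : 0 < |b.det p| := by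
    obtain ⟨ε, hε, hball⟩ := Metric.mem_nhds_iff.1 hQ.mem_nhds
    have hmem : (fun i => (ε / 2) • b i) ∈ Set.univ.pi fun _ : Fin n => Q := by
      intro i _
      apply hball
      rw [mem_ball_zero_iff, norm_smul, Real.norm_of_nonneg (by positivity)]
      simp [hb, hε]
    refine lt_of_lt_of_le ?_ (hmax hmem)
    have := b.det.map_smul_univ (fun _ : Fin n => ε / 2) b
    simp only [Module.Basis.det_self, smul_eq_mul, mul_one] at this
    simp only [this]
    positivity
  have hunit : IsUnit (b.det p) := (abs_pos.1 hpos).isUnit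
  obtain ⟨hli, hsp⟩ := (Module.Basis.is_basis_iff_det b).2 hunit
  refine ⟨Module.Basis.mk hli hsp.ge, fun i => ?_, fun x hx i => ?_⟩
  · rw [Module.Basis.mk_apply]; exact hp i (Set.mem_univ i)
  -- Cramer's rule: a coordinate of `x` times `det p` is the determinant with `x` substituted for `p
  -- i`, which maximality bounds by `|det p|`.
  · have h1 := congrArg (fun φ => φ x) (b.det_smul_mk_coord_eq_det_update hli hsp.ge i)
    simp only [LinearMap.smul_apply, smul_eq_mul, Module.Basis.coord_apply,
      MultilinearMap.toLinearMap_apply] at h1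
    have h2 : |b.det (Function.update p i x)| ≤ |b.det p| := by
      refine hmax fun j _ => ?_
      rcases eq_or_ne j i with rfl | hj
      · simpa using hx
      · simpa [hj] using hp j (Set.mem_univ j)
    have h3 : |b.det p| * |(Module.Basis.mk hli hsp.ge).repr x i| ≤ |b.det p| * 1 := by
      rw [← abs_mul, h1, mul_one]; exact h2
    exact le_of_mul_le_mul_left h3 hpos

/-- Every symmetric body is equivalent, up to the factor `√n`, to an orthogonal box. -/
theorem IsSymmBody.exists_box {Q : Set (EuclideanSpace ℝ (Fin n))} (hQ : IsSymmBody Q) :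
    ∃ (e : OrthonormalBasis (Fin n) ℝ (EuclideanSpace ℝ (Fin n))) (a : Fin n → ℝ),
      Monotone a ∧ (∀ i, 0 < a i) ∧ (∀ x ∈ Q, ∀ i, |⟪e i, x⟫| ≤ √n * a i) ∧
        ∀ u i, a i * |⟪e i, u⟫| ≤ √n * supportFn Q u := by
  obtain ⟨p, hpQ, hp⟩ := hQ.exists_basis
  -- The quadratic form of `S` is `∑ ⟪p j, u⟫ ^ 2`. Its eigenvectors give the directions of the box
  -- and the square roots of its eigenvalues give the axes.
  let S : EuclideanSpace ℝ (Fin n) →ₗ[ℝ] EuclideanSpace ℝ (Fin n) :=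
    ∑ j, (innerₗ (EuclideanSpace ℝ (Fin n)) (p j)).smulRight (p j)
  have hS : ∀ x y, ⟪S x, y⟫ = ∑ j, ⟪p j, x⟫ * ⟪p j, y⟫ := fun x y => by
    simp [S, LinearMap.sum_apply, sum_inner, inner_smul_left]
  have hsym : S.IsSymmetric := fun x y => by
    rw [hS, real_inner_comm, hS]; simp only [mul_comm]
  have hfr : Module.finrank ℝ (EuclideanSpace ℝ (Fin n)) = n := by simp
  set f := hsym.eigenvectorBasis hfr with hf
  set l := hsym.eigenvalues hfr with hl
  have hSf : ∀ i, S (f i) = l i • f i := fun i => hsym.apply_eigenvectorBasis hfr i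
  have hquad : ∀ u, ∑ j, ⟪p j, u⟫ ^ 2 = ∑ i, l i * ⟪f i, u⟫ ^ 2 := fun u => by
    have h1 := f.sum_inner_mul_inner (S u) u
    rw [hS] at h1
    simp only [pow_two]
    rw [← h1]
    refine Finset.sum_congr rfl fun i _ => ?_
    rw [hsym u (f i), hSf, inner_smul_right, real_inner_comm, mul_assoc]
  have hle : ∀ i, l i = ∑ j, ⟪p j, f i⟫ ^ 2 := fun i => by
    rw [hquad]
    simp [f.inner_eq_ite]
  have hlpos : ∀ i, 0 < l i := fun i => by
    refine lt_of_le_of_ne (by rw [hle]; positivity) fun h0 => ?_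
    -- A zero eigenvalue would make `f i` orthogonal to every vector of the basis `p`.
    rw [hle, eq_comm, Finset.sum_eq_zero_iff_of_nonneg fun _ _ => sq_nonneg _] at h0
    refine f.orthonormal.ne_zero i (inner_self_eq_zero (𝕜 := ℝ).1 ?_)
    conv_lhs => rw [← p.sum_repr (f i), sum_inner, p.sum_repr (f i)]
    refine Finset.sum_eq_zero fun j hj => ?_
    rw [inner_smul_left, pow_eq_zero_iff two_ne_zero |>.1 (h0 j hj), mul_zero]
  -- Eigenvalues are listed in decreasing order, the axes of the box in increasing order.
  refine ⟨f.reindex Fin.revPerm, fun i => √(l i.rev), ?_, fun i => Real.sqrt_pos.2 (hlpos _),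
    ?_, ?_⟩
  · intro i j hij
    exact Real.sqrt_le_sqrt (hsym.eigenvalues_antitone hfr (Fin.rev_le_rev.2 hij))
  · intro x hx i
    simp only [OrthonormalBasis.reindex_apply, Fin.revPerm_symm, Fin.revPerm_apply]
    rw [← Real.sqrt_mul (Nat.cast_nonneg n)]
    refine Real.le_sqrt_of_sq_le ?_
    have h1 : |⟪f i.rev, x⟫| ≤ ∑ j, |⟪p j, f i.rev⟫| := by
      conv_lhs => rw [← p.sum_repr x, inner_sum]
      refine (Finset.abs_sum_le_sum_abs _ _).trans (Finset.sum_le_sum fun j _ => ?_)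
      rw [inner_smul_right, abs_mul, real_inner_comm]
      exact mul_le_of_le_one_left (abs_nonneg _) (hp x hx j)
    calc |⟪f i.rev, x⟫| ^ 2 ≤ (∑ j, |⟪p j, f i.rev⟫|) ^ 2 := by gcongr
      _ ≤ (Finset.univ : Finset (Fin n)).card * ∑ j, |⟪p j, f i.rev⟫| ^ 2 :=
        sq_sum_le_card_mul_sum_sq
      _ = n * l i.rev := by simp [hle]
  · intro u i
    simp only [OrthonormalBasis.reindex_apply, Fin.revPerm_symm, Fin.revPerm_apply]
    have hn0 : (0 : ℝ) ≤ n := Nat.cast_nonneg n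
    have hsupp : 0 ≤ supportFn Q u :=
      (abs_nonneg _).trans (hQ.abs_inner_le_supportFn (x := u) hQ.zero_mem)
    refine abs_le_of_sq_le_sq' ?_ (by positivity) |>.2
    rw [mul_pow, mul_pow, Real.sq_sqrt (hlpos _).le, Real.sq_sqrt hn0, sq_abs]
    calc l i.rev * ⟪f i.rev, u⟫ ^ 2 ≤ ∑ i, l i * ⟪f i, u⟫ ^ 2 :=
          Finset.single_le_sum (f := fun i => l i * ⟪f i, u⟫ ^ 2)
            (fun i _ => mul_nonneg (hlpos i).le (sq_nonneg _)) (Finset.mem_univ _)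
      _ = ∑ j, ⟪p j, u⟫ ^ 2 := (hquad u).symm
      _ ≤ ∑ j : Fin n, supportFn Q u ^ 2 := Finset.sum_le_sum fun j _ => by
          rw [← sq_abs, real_inner_comm]
          gcongr
          exact hQ.abs_inner_le_supportFn (hpQ j)
      _ = n * supportFn Q u ^ 2 := by simp

/-- A point of the ball outside `Q` would be strictly separated from `Q` by some `u`, contradicting
the lower bound on the support function at `u`. -/
theorem IsSymmBody.closedBall_subset {Q : Set (EuclideanSpace ℝ (Fin n))} (hQ : IsSymmBody Q)
    {r : ℝ} (h : ∀ u, r * ‖u‖ ≤ supportFn Q u) : Metric.closedBall 0 r ⊆ Q := by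
  intro x hx
  by_contra hxQ
  obtain ⟨φ, c, h1, h2⟩ := geometric_hahn_banach_closed_point hQ.convex hQ.isCompact.isClosed hxQ
  set u := (InnerProductSpace.toDual ℝ (EuclideanSpace ℝ (Fin n))).symm φ with hu
  have hφ : ∀ y, φ y = ⟪u, y⟫ := fun y => by simp [hu]
  obtain ⟨y, hy, hyu⟩ := hQ.exists_supportFn_eq u
  have h3 := h1 y hy
  rw [hφ, ← hyu] at h3
  rw [hφ] at h2
  have h4 := real_inner_le_norm u x
  have h5 : ‖u‖ * ‖x‖ ≤ ‖u‖ * r :=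
    mul_le_mul_of_nonneg_left (mem_closedBall_zero_iff.1 hx) (norm_nonneg u)
  have := h u
  linarith

/-! ### Integrals of negative powers of the support function. -/

/-- A sphere integral is bounded by `n` times the integral over the unit ball of any function that
dominates the radially constant extension of the integrand. -/
theorem integral_toSphere_le (hn : n ≠ 0)
    {f : Metric.sphere (0 : EuclideanSpace ℝ (Fin n)) 1 → ℝ}
    (hf : Integrable f (volume : Measure (EuclideanSpace ℝ (Fin n))).toSphere)
    {G : EuclideanSpace ℝ (Fin n) → ℝ} (hG : Integrable G) (hG0 : ∀ x, 0 ≤ G x)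
    (h : ∀ᵐ x : EuclideanSpace ℝ (Fin n), ‖x‖ < 1 →
      ∀ u : Metric.sphere (0 : EuclideanSpace ℝ (Fin n)) 1, (u : EuclideanSpace ℝ (Fin n)) =
        ‖x‖⁻¹ • x → f u ≤ G x) :
    ∫ u, f u ∂(volume : Measure (EuclideanSpace ℝ (Fin n))).toSphere ≤ n * ∫ x, G x := by
  have : Nonempty (Fin n) := ⟨⟨0, Nat.pos_of_ne_zero hn⟩⟩
  let E := EuclideanSpace ℝ (Fin n)
  set ν := Measure.volumeIoiPow (Module.finrank ℝ E - 1)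
  set σ := (volume : Measure E).toSphere
  set I : Set (Set.Ioi (0 : ℝ)) := Set.Iio ⟨1, Set.mem_Ioi.2 one_pos⟩
  -- In polar coordinates the radial measure of `(0, 1)` is `∫₀¹ r ^ (n - 1) dr`, the source of the
  -- factor `n`.
  have hνI : ν I = ENNReal.ofReal (1 / n) := by
    have h1 : Module.finrank ℝ E - 1 + 1 = n := by
      simp only [E, finrank_euclideanSpace_fin]; omega
    have h2 : ((Module.finrank ℝ E - 1 : ℕ) : ℝ) + 1 = n := by exact_mod_cast h1
    simp only [ν, I, Measure.volumeIoiPow_apply_Iio, h2, one_pow]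
  have hind : Integrable (I.indicator fun _ => (1 : ℝ)) ν :=
    (integrable_indicator_iff measurableSet_Iio).2
      (integrableOn_const (by rw [hνI]; exact ENNReal.ofReal_ne_top))
  have hmp := (volume : Measure E).measurePreserving_homeomorphUnitSphereProd
  have hemb := (homeomorphUnitSphereProd E).measurableEmbedding
  have hprod : Integrable (fun p : Metric.sphere (0 : E) 1 × Set.Ioi (0 : ℝ) =>
      f p.1 * I.indicator (fun _ => (1 : ℝ)) p.2) (σ.prod ν) := hf.mul_prod hind
  have hval : ∫ p, f p.1 * I.indicator (fun _ => (1 : ℝ)) p.2 ∂(σ.prod ν) =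
      (∫ u, f u ∂σ) * (1 / n) := by
    rw [integral_prod_mul, integral_indicator_const _ measurableSet_Iio, measureReal_def, hνI,
      ENNReal.toReal_ofReal (by positivity), smul_eq_mul, mul_one]
  have hmeas : MeasurableSet ({0}ᶜ : Set E) := (measurableSet_singleton _).compl
  have hle : (∫ u, f u ∂σ) * (1 / n) ≤ ∫ x, G x := by
    rw [← hval, ← hmp.integral_comp hemb]
    calc _ ≤ ∫ x : ({0}ᶜ : Set E), G (x : E) ∂((volume : Measure E).comap Subtype.val) := by
          refine integral_mono_ae ((hmp.integrable_comp_emb hemb).2 hprod)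
            ((integrableOn_iff_comap_subtypeVal hmeas).1 hG.integrableOn) ?_
          have hae := (ae_restrict_iff_subtype hmeas).1 (ae_restrict_of_ae (s := {0}ᶜ) h)
          filter_upwards [hae] with x hx
          by_cases hx1 : ‖(x : E)‖ < 1
          · have : (homeomorphUnitSphereProd E x).2 ∈ I := by
              simpa [I, ← Subtype.coe_lt_coe] using hx1
            rw [Set.indicator_of_mem this, mul_one]
            exact hx hx1 _ (by simp)
          · have : (homeomorphUnitSphereProd E x).2 ∉ I := by
              simpa [I, ← Subtype.coe_lt_coe] using hx1
            rw [Set.indicator_of_notMem this, mul_zero]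
            exact hG0 x
      _ = ∫ x, G x := by
          rw [integral_subtype_comap hmeas G, restrict_compl_singleton]
  have hn' : (0 : ℝ) < n := by positivity
  rwa [mul_one_div, div_le_iff₀' hn'] at hle

/-- The function `t ↦ |t| ^ (-β)`, cut off outside `[-1, 1]`. -/
noncomputable def truncRpow (β t : ℝ) : ℝ := (Set.Icc (-1) 1).indicator (fun t => |t| ^ (-β)) t

theorem truncRpow_nonneg (β t : ℝ) : 0 ≤ truncRpow β t :=
  Set.indicator_nonneg (fun t _ => Real.rpow_nonneg (abs_nonneg t) _) t

theorem integrable_truncRpow {β : ℝ} (hβ : β < 1) : Integrable (truncRpow β) := by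
  have h1 : IntervalIntegrable (fun t : ℝ => |t| ^ (-β)) volume 0 1 :=
    (intervalIntegral.intervalIntegrable_rpow' (r := -β) (by linarith)).congr fun t ht => by
      rw [Set.uIoc_of_le zero_le_one] at ht
      rw [abs_of_pos ht.1]
  have h2 : IntervalIntegrable (fun t : ℝ => |t| ^ (-β)) volume (-1) 0 := by
    rw [IntervalIntegrable.iff_comp_neg]
    simpa using h1.symm
  have h3 := (intervalIntegrable_iff_integrableOn_Icc_of_le (by norm_num)).1 (h2.trans h1)
  exact (integrable_indicator_iff measurableSet_Icc).2 h3

theorem coords_eq_comp (e : OrthonormalBasis (Fin n) ℝ (EuclideanSpace ℝ (Fin n))) :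
    (fun x : EuclideanSpace ℝ (Fin n) => fun i => ⟪e i, x⟫) = WithLp.ofLp ∘ e.repr := by
  funext x i
  simp [e.repr_apply_apply]

theorem measurePreserving_coords (e : OrthonormalBasis (Fin n) ℝ (EuclideanSpace ℝ (Fin n))) :
    MeasurePreserving (fun x : EuclideanSpace ℝ (Fin n) => fun i => ⟪e i, x⟫) volume volume := by
  rw [coords_eq_comp]
  exact (PiLp.volume_preserving_ofLp (Fin n)).comp e.measurePreserving_repr

theorem measurableEmbedding_coords
    (e : OrthonormalBasis (Fin n) ℝ (EuclideanSpace ℝ (Fin n))) :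
    MeasurableEmbedding (fun x : EuclideanSpace ℝ (Fin n) => fun i => ⟪e i, x⟫) := by
  rw [coords_eq_comp]
  exact (MeasurableEquiv.toLp 2 (Fin n → ℝ)).symm.measurableEmbedding.comp
    e.measurableEquiv.measurableEmbedding

theorem integrable_prod_truncRpow {β : Fin n → ℝ} (hβ : ∀ i, β i < 1)
    (e : OrthonormalBasis (Fin n) ℝ (EuclideanSpace ℝ (Fin n))) :
    Integrable fun x : EuclideanSpace ℝ (Fin n) => ∏ i, truncRpow (β i) ⟪e i, x⟫ :=
  ((measurePreserving_coords e).integrable_comp_emb (measurableEmbedding_coords e)).2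
    (Integrable.fintype_prod (f := fun i => truncRpow (β i)) fun i => integrable_truncRpow (hβ i))

theorem integral_prod_truncRpow (β : Fin n → ℝ)
    (e : OrthonormalBasis (Fin n) ℝ (EuclideanSpace ℝ (Fin n))) :
    ∫ x : EuclideanSpace ℝ (Fin n), ∏ i, truncRpow (β i) ⟪e i, x⟫ = ∏ i, ∫ t, truncRpow (β i) t := by
  rw [← integral_fintype_prod_volume_eq_prod, ← (measurePreserving_coords e).integral_comp
    (measurableEmbedding_coords e)]

theorem ae_inner_ne_zero (e : OrthonormalBasis (Fin n) ℝ (EuclideanSpace ℝ (Fin n))) :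
    ∀ᵐ x : EuclideanSpace ℝ (Fin n), ∀ i, ⟪e i, x⟫ ≠ 0 := by
  refine ae_all_iff.2 fun i => ?_
  have := Measure.addHaar_submodule (volume : Measure (EuclideanSpace ℝ (Fin n)))
    (LinearMap.ker (innerₗ (EuclideanSpace ℝ (Fin n)) (e i))) fun h => by
      have : e i ∈ LinearMap.ker (innerₗ (EuclideanSpace ℝ (Fin n)) (e i)) := h ▸ trivial
      simp at this
  rw [ae_iff]
  convert this using 2
  ext x
  simp

/-- A unit vector has a coordinate of absolute value at least `1 / √n`. -/
theorem exists_one_le_sqrt_mul_abs_inner (hn : n ≠ 0)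
    (e : OrthonormalBasis (Fin n) ℝ (EuclideanSpace ℝ (Fin n)))
    {u : EuclideanSpace ℝ (Fin n)} (hu : ‖u‖ = 1) : ∃ k, 1 ≤ √n * |⟪e k, u⟫| := by
  by_contra! hcon
  have : Nonempty (Fin n) := ⟨⟨0, Nat.pos_of_ne_zero hn⟩⟩
  have h1 : ∑ i, (√n * |⟪e i, u⟫|) ^ 2 < ∑ i : Fin n, (1 : ℝ) := by
    refine Finset.sum_lt_sum_of_nonempty Finset.univ_nonempty fun i _ => ?_
    exact pow_lt_one₀ (by positivity) (hcon i) two_ne_zero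
  simp only [mul_pow, sq_abs, Real.sq_sqrt (Nat.cast_nonneg n), ← Finset.mul_sum] at h1
  have h2 := e.sum_sq_norm_inner_right u
  simp only [Real.norm_eq_abs, sq_abs, hu] at h2
  rw [h2] at h1
  simp at h1

theorem abs_inner_le_norm_of_basis (e : OrthonormalBasis (Fin n) ℝ (EuclideanSpace ℝ (Fin n)))
    (x : EuclideanSpace ℝ (Fin n)) (i : Fin n) : |⟪e i, x⟫| ≤ ‖x‖ := by
  simpa using abs_real_inner_le_norm (e i) x

/-- The exponents of the integrand that dominates the support function of a box: the coordinate
along the shortest axis is not used. -/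
def tailExponent (q : ℝ) (θ : Fin n → ℝ) (i : Fin n) : ℝ := if (i : ℕ) = 0 then 0 else q * θ i

/-- Split `h ^ (-q)` into the factors `h ^ (-q θᵢ)` and bound `h` from below by a different axis in
each. Some coordinate `k` of `u` is at least `1 / √n`, so `h ≥ a_k / n`; this covers every `i ≤ k`,
in particular `i = 0`, without a coordinate of `u`. For `i > k` the box bound is used directly. -/
theorem supportFn_rpow_le (hn : n ≠ 0) {q : ℝ} (hq : 0 < q) {θ : Fin n → ℝ} (hθ : ∀ i, 0 ≤ θ i)
    (hθ1 : ∑ i, θ i = 1) (e : OrthonormalBasis (Fin n) ℝ (EuclideanSpace ℝ (Fin n)))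
    {a : Fin n → ℝ} (ha : Monotone a) (ha0 : ∀ i, 0 < a i) {u : EuclideanSpace ℝ (Fin n)}
    (hu : ‖u‖ = 1) (hu0 : ∀ i, ⟪e i, u⟫ ≠ 0) {h : ℝ} (hh : ∀ i, a i * |⟪e i, u⟫| ≤ √n * h) :
    h ^ (-q) ≤ (∏ i, (1 / (n : ℝ)) ^ (-(q * θ i))) * (∏ i, a i ^ (-(q * θ i))) *
      ∏ i, |⟪e i, u⟫| ^ (-tailExponent q θ i) := by
  have hn' : (0 : ℝ) < n := by positivity
  have hn1 : (1 : ℝ) ≤ n := by exact_mod_cast Nat.one_le_iff_ne_zero.2 hn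
  have hsn : 0 < √(n : ℝ) := Real.sqrt_pos.2 hn'
  have hss : √(n : ℝ) * √(n : ℝ) = n := Real.mul_self_sqrt hn'.le
  have hs1 : 1 ≤ √(n : ℝ) := Real.one_le_sqrt.2 hn1
  obtain ⟨k, hk⟩ := exists_one_le_sqrt_mul_abs_inner hn e hu
  have hpos : ∀ i, 0 < |⟪e i, u⟫| := fun i => abs_pos.2 (hu0 i)
  have hle1 : ∀ i, |⟪e i, u⟫| ≤ 1 := fun i => hu ▸ abs_inner_le_norm_of_basis e u i
  have hak : a k ≤ n * h := by
    calc a k ≤ a k * (√n * |⟪e k, u⟫|) := le_mul_of_one_le_right (ha0 k).le hk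
      _ = √n * (a k * |⟪e k, u⟫|) := by ring
      _ ≤ √n * (√n * h) := mul_le_mul_of_nonneg_left (hh k) hsn.le
      _ = n * h := by rw [← mul_assoc, hss]
  have hh0 : 0 < h := pos_of_mul_pos_right ((ha0 k).trans_le hak) hn'.le
  set v : Fin n → ℝ := fun i => if (i : ℕ) = 0 then 1 else |⟪e i, u⟫| with hv
  have hv0 : ∀ i, 0 < v i := fun i => by
    simp only [hv]; split_ifs; exacts [one_pos, hpos i]
  have hv1 : ∀ i, v i ≤ 1 := fun i => by
    simp only [hv]; split_ifs; exacts [le_rfl, hle1 i]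
  have hav : ∀ i, a i * v i ≤ n * h := fun i => by
    rcases le_or_gt i k with hik | hik
    · calc a i * v i ≤ a i := mul_le_of_le_one_right (ha0 i).le (hv1 i)
        _ ≤ a k := ha hik
        _ ≤ n * h := hak
    · have : (i : ℕ) ≠ 0 := by have : (k : ℕ) < i := hik; omega
      simp only [hv, if_neg this]
      refine (hh i).trans ?_
      exact mul_le_mul_of_nonneg_right ((le_mul_of_one_le_left hsn.le hs1).trans_eq hss) hh0.le
  have hexp : -q = ∑ i, -(q * θ i) := by
    rw [Finset.sum_neg_distrib, ← Finset.mul_sum, hθ1, mul_one]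
  rw [hexp, Real.rpow_sum_of_pos hh0, ← Finset.prod_mul_distrib, ← Finset.prod_mul_distrib]
  refine Finset.prod_le_prod (fun i _ => Real.rpow_nonneg hh0.le _) fun i _ => ?_
  have h1 : 1 / (n : ℝ) * a i * v i ≤ h := by
    rw [mul_assoc, one_div, inv_mul_le_iff₀ hn']; exact hav i
  have h2 : 0 < 1 / (n : ℝ) * a i := mul_pos (by positivity) (ha0 i)
  refine (Real.rpow_le_rpow_of_nonpos (mul_pos h2 (hv0 i)) h1
    (neg_nonpos.2 (mul_nonneg hq.le (hθ i)))).trans_eq ?_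
  rw [Real.mul_rpow h2.le (hv0 i).le, Real.mul_rpow (by positivity) (ha0 i).le]
  congr 1
  simp only [hv, tailExponent]
  split_ifs <;> simp

/-- The sphere integral of a negative power of the support function of a body that contains a box,
up to a factor, is bounded by a weighted geometric mean of the axes of the box. -/
theorem exists_integral_supportFn_le (hn : n ≠ 0) {q : ℝ} (hq : 0 < q) {θ : Fin n → ℝ}
    (hθ : ∀ i, 0 ≤ θ i) (hθ1 : ∑ i, θ i = 1) (hθq : ∀ i : Fin n, (i : ℕ) ≠ 0 → q * θ i < 1) :
    ∃ C : ℝ, 0 ≤ C ∧ ∀ (e : OrthonormalBasis (Fin n) ℝ (EuclideanSpace ℝ (Fin n))) (a : Fin n → ℝ)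
      (Q : Set (EuclideanSpace ℝ (Fin n))), Monotone a → (∀ i, 0 < a i) → IsSymmBody Q →
      (∀ u i, a i * |⟪e i, u⟫| ≤ √n * supportFn Q u) →
      ∫ u, supportFn Q u ^ (-q) ∂(volume : Measure (EuclideanSpace ℝ (Fin n))).toSphere ≤
        C * ∏ i, a i ^ (-(q * θ i)) := by
  have hβ0 : ∀ i, 0 ≤ tailExponent q θ i := fun i => by
    unfold tailExponent; split_ifs; exacts [le_rfl, mul_nonneg hq.le (hθ i)]
  have hβ1 : ∀ i, tailExponent q θ i < 1 := fun i => by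
    unfold tailExponent; split_ifs with h; exacts [one_pos, hθq i h]
  refine ⟨n * ((∏ i, (1 / (n : ℝ)) ^ (-(q * θ i))) * ∏ i, ∫ t, truncRpow (tailExponent q θ i) t),
    ?_, ?_⟩
  · have : ∀ i, 0 ≤ ∫ t, truncRpow (tailExponent q θ i) t :=
      fun i => integral_nonneg fun t => truncRpow_nonneg _ t
    have := Finset.prod_nonneg fun i (_ : i ∈ Finset.univ) => this i
    positivity
  intro e a Q ha ha0 hQ hh
  set c := (∏ i, (1 / (n : ℝ)) ^ (-(q * θ i))) * ∏ i, a i ^ (-(q * θ i)) with hc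
  have hc0 : 0 ≤ c := mul_nonneg (by positivity)
    (Finset.prod_nonneg fun i _ => Real.rpow_nonneg (ha0 i).le _)
  refine (integral_toSphere_le hn (hQ.integrable_supportFn_rpow _ _)
    (G := fun x => c * ∏ i, truncRpow (tailExponent q θ i) ⟪e i, x⟫)
    ((integrable_prod_truncRpow hβ1 e).const_mul c)
    (fun x => mul_nonneg hc0 (Finset.prod_nonneg fun i _ => truncRpow_nonneg _ _)) ?_).trans_eq ?_
  · filter_upwards [ae_inner_ne_zero e] with x hx hx1 u hu
    have hx0 : 0 < ‖x‖ := norm_pos_iff.2 fun h => hx ⟨0, Nat.pos_of_ne_zero hn⟩ (by simp [h])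
    have hui : ∀ i, ⟪e i, (u : EuclideanSpace ℝ (Fin n))⟫ = ‖x‖⁻¹ * ⟪e i, x⟫ := fun i => by
      rw [hu, inner_smul_right]
    refine (supportFn_rpow_le hn hq hθ hθ1 e ha ha0 (norm_eq_of_mem_sphere u)
      (fun i => by rw [hui]; exact mul_ne_zero (inv_ne_zero hx0.ne') (hx i))
      (hh u)).trans (mul_le_mul_of_nonneg_left ?_ hc0)
    refine Finset.prod_le_prod (fun i _ => Real.rpow_nonneg (abs_nonneg _) _) fun i _ => ?_
    have hi := abs_inner_le_norm_of_basis e x i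
    rw [truncRpow, Set.indicator_of_mem (Set.mem_Icc.2 (abs_le.1 (hi.trans hx1.le)))]
    -- Since `‖x‖ < 1`, the coordinates of `x` are no larger than those of `u = x / ‖x‖`, so
    -- negative powers only grow; the resulting bound is a product over coordinates and Fubini
    -- applies.
    refine Real.rpow_le_rpow_of_nonpos (abs_pos.2 (hx i)) ?_ (neg_nonpos.2 (hβ0 i))
    rw [hui, abs_mul, abs_of_pos (inv_pos.2 hx0)]
    exact le_mul_of_one_le_left (abs_nonneg _) (one_le_inv_iff₀.2 ⟨hx0, hx1.le⟩)
  · rw [integral_const_mul, integral_prod_truncRpow, hc]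
    ring

/-! ### Weights supplied by the subspace mass inequality. -/

theorem tailSpan_mono (e : OrthonormalBasis (Fin n) ℝ (EuclideanSpace ℝ (Fin n))) {i j : ℕ}
    (hij : i ≤ j) : tailSpan e j ≤ tailSpan e i :=
  Submodule.span_mono (Set.image_mono fun _ hk => hij.trans hk)

theorem mem_tailSpan_of_inner_eq_zero
    (e : OrthonormalBasis (Fin n) ℝ (EuclideanSpace ℝ (Fin n))) {i : ℕ}
    {u : EuclideanSpace ℝ (Fin n)} (hu : ∀ j : Fin n, (j : ℕ) < i → ⟪e j, u⟫ = 0) :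
    u ∈ tailSpan e i := by
  rw [← e.sum_repr' u]
  refine Submodule.sum_mem _ fun j _ => ?_
  rcases lt_or_ge (j : ℕ) i with hj | hj
  · rw [hu j hj, zero_smul]; exact Submodule.zero_mem _
  · exact Submodule.smul_mem _ _ (Submodule.subset_span ⟨j, hj, rfl⟩)

theorem massRatio_mono (μ : Measure (Metric.sphere (0 : EuclideanSpace ℝ (Fin n)) 1))
    [IsFiniteMeasure μ] {ξ η : Submodule ℝ (EuclideanSpace ℝ (Fin n))} (h : ξ ≤ η) :
    massRatio μ ξ ≤ massRatio μ η :=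
  div_le_div_of_nonneg_right (measureReal_mono fun _ hu => h hu) measureReal_nonneg

/-- `W` is the sequence of tail sums of the weights `θᵢ = Wᵢ - Wᵢ₊₁`. The bounds `1 - i s` of the
mass inequality almost serve: their drops satisfy `q s ≤ 1` because `q ≤ n`, and the last drop `1 -
m` satisfies `q (1 - m) ≤ 1`. A factor `1 - η` for `1 ≤ i < n` makes these strict, the strict mass
inequality leaves room for it, and the lost weight goes to `θ₀`, which is not constrained. -/
theorem exists_weights {q : ℝ} (hq : q ∈ Set.Ioc (0 : ℝ) n)
    (μ : Measure (Metric.sphere (0 : EuclideanSpace ℝ (Fin n)) 1)) [IsFiniteMeasure μ]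
    {e : OrthonormalBasis (Fin n) ℝ (EuclideanSpace ℝ (Fin n))}
    (hsub : SubspaceMassIneqWrt q μ e) :
    ∃ W : ℕ → ℝ, W 0 = 1 ∧ W n = 0 ∧ (∀ i < n, W (i + 1) ≤ W i) ∧
      (∀ i < n, i ≠ 0 → q * (W i - W (i + 1)) < 1) ∧
      ∀ i < n, i ≠ 0 → massRatio μ (tailSpan e i) < W i := by
  obtain ⟨hq0, hqn⟩ := hq
  have hn : n ≠ 0 := by rintro rfl; simp at hqn; linarith
  set m : ℝ := max 0 (1 - 1 / q) with hm
  set s : ℝ := m / ((n : ℝ) - 1) with hs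
  have hqq : q * (1 / q) = 1 := mul_one_div_cancel hq0.ne'
  have hn1 : (1 : ℝ) ≤ n := by exact_mod_cast Nat.one_le_iff_ne_zero.2 hn
  have hm0 : 0 ≤ m := le_max_left _ _
  have hm1 : m < 1 := max_lt one_pos (by have : 0 < 1 / q := by positivity
                                         linarith)
  have hqm : q * m ≤ n - 1 := by
    rw [hm, mul_max_of_nonneg _ _ hq0.le]
    exact max_le (by linarith) (by linarith)
  have hqm1 : q * (1 - m) ≤ 1 := by
    have : q * (1 - 1 / q) ≤ q * m := mul_le_mul_of_nonneg_left (le_max_right _ _) hq0.le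
    linarith
  have hs0 : 0 ≤ s := div_nonneg hm0 (by linarith)
  have hsm : ∀ i : ℕ, i < n → i * s ≤ m := fun i hi => by
    have hi' : (i : ℝ) ≤ n - 1 := by
      have : (i : ℝ) + 1 ≤ n := by exact_mod_cast hi
      linarith
    -- For `n = 1` the denominator of `s` is zero, but then only `i = 0` occurs.
    rcases eq_or_lt_of_le hn1 with h1 | h1
    · have : (i : ℝ) = 0 := le_antisymm (by linarith) (Nat.cast_nonneg i)
      rw [this, zero_mul]; exact hm0
    · rw [hs, mul_div_assoc', div_le_iff₀ (by linarith), mul_comm]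
      exact mul_le_mul_of_nonneg_left hi' hm0
  have hqs : q * s ≤ 1 := by
    rw [hs, mul_div_assoc']
    exact div_le_one_of_le₀ hqm (by linarith)
  have hmass : ∀ i < n, i ≠ 0 → massRatio μ (tailSpan e i) < 1 - i * s := fun i hi hi0 => by
    rcases le_or_gt 1 q with h1 | h1
    · have := hsub.1 h1 i (Nat.one_le_iff_ne_zero.2 hi0) hi
      rwa [hs, hm, max_eq_right (by rw [sub_nonneg, div_le_one hq0]; exact h1), mul_div_assoc',
        ← div_mul_eq_mul_div]
    -- For `q < 1` the slope `s` vanishes, and the single hypothesis on the hyperplane bounds all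
    -- smaller tail subspaces.
    · have h2 : m = 0 := max_eq_left (by rw [sub_nonpos, le_div_iff₀ hq0]; linarith)
      rw [hs, h2, zero_div, mul_zero, sub_zero]
      exact (massRatio_mono μ (tailSpan_mono e (Nat.one_le_iff_ne_zero.2 hi0))).trans_lt (hsub.2 h1)
  obtain ⟨η, hη, hη0, hη1⟩ : ∃ η : ℝ, (∀ i ∈ Finset.range n, i ≠ 0 →
      massRatio μ (tailSpan e i) < (1 - η) * (1 - i * s)) ∧ 0 < η ∧ η < 1 := by
    have h1 : ∀ᶠ η : ℝ in 𝓝[>] 0, ∀ i ∈ Finset.range n, i ≠ 0 →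
        massRatio μ (tailSpan e i) < (1 - η) * (1 - i * s) := by
      rw [eventually_all_finset]
      intro i hi
      by_cases hi0 : i = 0
      · simp [hi0]
      · have hc : Tendsto (fun η : ℝ => (1 - η) * (1 - i * s)) (𝓝[>] 0) (𝓝 (1 - i * s)) := by
          have : Tendsto (fun η : ℝ => (1 - η) * (1 - i * s)) (𝓝 0)
              (𝓝 ((1 - 0) * (1 - i * s))) := Continuous.tendsto (by fun_prop) 0
          simpa using this.mono_left nhdsWithin_le_nhds
        filter_upwards [hc.eventually_const_lt (hmass i (Finset.mem_range.1 hi) hi0)] with η h _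
        exact h
    obtain ⟨η, h2, h3⟩ := (h1.and (Ioo_mem_nhdsGT one_pos)).exists
    exact ⟨η, h2, h3.1, h3.2⟩
  refine ⟨fun i => if i = 0 then 1 else if i < n then (1 - η) * (1 - i * s) else 0, by simp,
    by simp [hn], fun i hi => ?_, fun i hi hi0 => ?_, fun i hi hi0 => ?_⟩
  · simp only [if_neg (Nat.succ_ne_zero i)]
    rcases eq_or_ne i 0 with rfl | hi0
    · rw [if_pos rfl]
      split_ifs with h
      · have := hsm 1 h
        push_cast at this ⊢
        exact mul_le_one₀ (by linarith) (by linarith) (by linarith)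
      · exact zero_le_one
    · rw [if_neg hi0, if_pos hi]
      have h1 : (0 : ℝ) ≤ 1 - η := by linarith
      split_ifs with h
      · push_cast
        exact mul_le_mul_of_nonneg_left (by linarith) h1
      · exact mul_nonneg h1 (by linarith [hsm i hi])
  · simp only [if_neg (Nat.succ_ne_zero i), if_neg hi0, if_pos hi]
    split_ifs with h
    · push_cast
      have : q * ((1 - η) * (1 - i * s) - (1 - η) * (1 - (i + 1) * s)) = (1 - η) * (q * s) := by
        ring
      rw [this]
      calc (1 - η) * (q * s) ≤ (1 - η) * 1 := mul_le_mul_of_nonneg_left hqs (by linarith)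
        _ < 1 := by linarith
    · have hin : i + 1 = n := by omega
      have hin' : (i : ℝ) = n - 1 := by rw [← hin]; push_cast; ring
      have h1 : (i : ℝ) * s = m := by
        have : (n : ℝ) - 1 ≠ 0 := by rw [← hin']; exact_mod_cast hi0
        rw [hs, hin']; field_simp
      rw [h1, sub_zero, show q * ((1 - η) * (1 - m)) = (1 - η) * (q * (1 - m)) by ring]
      calc (1 - η) * (q * (1 - m)) ≤ (1 - η) * 1 := mul_le_mul_of_nonneg_left hqm1 (by linarith)
        _ < 1 := by linarith
  · simp only [if_neg hi0, if_pos hi]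
    exact hη i (Finset.mem_range.2 hi) hi0

/-! ### Averages of the logarithm of the radial function. -/

/-- The part of the sphere where the first `i` coordinates are smaller than `δ`. -/
def slab (e : Fin n → EuclideanSpace ℝ (Fin n)) (i : ℕ) (δ : ℝ) :
    Set (Metric.sphere (0 : EuclideanSpace ℝ (Fin n)) 1) :=
  {u | ∀ j : Fin n, (j : ℕ) < i → |⟪e j, (u : EuclideanSpace ℝ (Fin n))⟫| < δ}

theorem measurableSet_slab (e : Fin n → EuclideanSpace ℝ (Fin n)) (i : ℕ) (δ : ℝ) :
    MeasurableSet (slab e i δ) := by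
  have : slab e i δ = ⋂ j : Fin n, ⋂ _ : (j : ℕ) < i,
      {u : Metric.sphere (0 : EuclideanSpace ℝ (Fin n)) 1 |
        |⟪e j, (u : EuclideanSpace ℝ (Fin n))⟫| < δ} := by
    ext u; simp [slab]
  rw [this]
  refine MeasurableSet.iInter fun j => MeasurableSet.iInter fun _ => ?_
  exact (isOpen_lt (by fun_prop) continuous_const).measurableSet

theorem slab_mono (e : Fin n → EuclideanSpace ℝ (Fin n)) (i : ℕ) {δ δ' : ℝ} (h : δ ≤ δ') :
    slab e i δ ⊆ slab e i δ' :=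
  fun _ hu j hj => (hu j hj).trans_le h

/-- Lets an estimate for slabs of width `2δ` at one basis serve for slabs of width `δ` at all bases
nearby. -/
theorem slab_subset_of_dist_le {e e' : Fin n → EuclideanSpace ℝ (Fin n)} {δ : ℝ}
    (h : dist e' e ≤ δ) (i : ℕ) : slab e' i δ ⊆ slab e i (2 * δ) := by
  intro u hu j hj
  have h1 : |⟪e j - e' j, (u : EuclideanSpace ℝ (Fin n))⟫| ≤ δ := by
    refine (abs_real_inner_le_norm _ _).trans ?_
    rw [norm_eq_of_mem_sphere, mul_one, ← dist_eq_norm, dist_comm]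
    exact (dist_le_pi_dist e' e j).trans h
  have h2 : ⟪e j, (u : EuclideanSpace ℝ (Fin n))⟫ =
      ⟪e' j, (u : EuclideanSpace ℝ (Fin n))⟫ + ⟪e j - e' j, (u : EuclideanSpace ℝ (Fin n))⟫ := by
    rw [inner_sub_left]; ring
  rw [h2]
  linarith [abs_add_le ⟪e' j, (u : EuclideanSpace ℝ (Fin n))⟫
    ⟪e j - e' j, (u : EuclideanSpace ℝ (Fin n))⟫, hu j hj]

/-- As `δ` decreases to `0` the slabs shrink to a set contained in the tail subspace; continuity
from above of the finite measure gives the limit. -/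
theorem eventually_slab_lt (μ : Measure (Metric.sphere (0 : EuclideanSpace ℝ (Fin n)) 1))
    [IsFiniteMeasure μ] (hμ : μ ≠ 0) (e : OrthonormalBasis (Fin n) ℝ (EuclideanSpace ℝ (Fin n)))
    (i : ℕ) {c : ℝ} (hc : massRatio μ (tailSpan e i) < c) :
    ∀ᶠ δ in 𝓝[>] (0 : ℝ), μ.real (slab e i δ) / μ.real Set.univ < c := by
  have hm : 0 < μ.real Set.univ := by
    simpa [measureReal_def, ENNReal.toReal_pos_iff, pos_iff_ne_zero] using hμ
  have h1 := tendsto_measure_biInter_gt (μ := μ) (s := slab e i) (a := 0)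
    (fun r _ => (measurableSet_slab e i r).nullMeasurableSet)
    (fun r r' _ h => slab_mono e i h) ⟨1, one_pos, measure_ne_top _ _⟩
  have h2 := (ENNReal.tendsto_toReal (measure_ne_top μ _)).comp h1
  have h3 : (μ (⋂ r > 0, slab e i r)).toReal < c * μ.real Set.univ := by
    rw [massRatio, div_lt_iff₀ hm] at hc
    refine lt_of_le_of_lt (measureReal_mono fun u hu => ?_) hc
    refine mem_tailSpan_of_inner_eq_zero e fun j hj => ?_
    have h4 : ∀ r > 0, |⟪e j, (u : EuclideanSpace ℝ (Fin n))⟫| < r := fun r hr =>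
      Set.mem_iInter₂.1 hu r hr j hj
    by_contra hne
    exact lt_irrefl _ (h4 _ (abs_pos.2 hne))
  filter_upwards [h2.eventually_lt_const h3] with δ hδ
  rw [div_lt_iff₀ hm]
  exact hδ

/-- Summation by parts, turning weights on the axes into tail sums on the increments. -/
theorem sum_sub_mul_eq (W t : ℕ → ℝ) (k : ℕ) :
    ∑ i ∈ Finset.range k, (W i - W (i + 1)) * t i =
      W 0 * t 0 + ∑ i ∈ Finset.range k, W (i + 1) * (t (i + 1) - t i) - W k * t k := by
  induction k with
  | zero => simp
  | succ k ih => rw [Finset.sum_range_succ, Finset.sum_range_succ, ih]; ring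

/-- The logarithms of the axes of a box, continued constantly. -/
noncomputable def logAxis (hn : n ≠ 0) (a : Fin n → ℝ) (i : ℕ) : ℝ :=
  Real.log (a ⟨min i (n - 1), by omega⟩)

theorem logAxis_val (hn : n ≠ 0) (a : Fin n → ℝ) (i : Fin n) :
    logAxis hn a i = Real.log (a i) := by
  unfold logAxis
  congr 2
  exact Fin.ext (min_eq_left (by omega))

theorem logAxis_mono (hn : n ≠ 0) {a : Fin n → ℝ} (ha : Monotone a) (ha0 : ∀ i, 0 < a i) :
    Monotone (logAxis hn a) := fun _ _ hij =>
  Real.log_le_log (ha0 _) (ha (Fin.mk_le_mk.2 (min_le_min_right _ hij)))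

/-- Let `k` be the first coordinate of `u` that is at least `δ` in absolute value. Then `δ ρ(u) ≤ √n
a_k`, and `log a_k` telescopes over `i < k`, for all of which `u` lies in the slab of index `i + 1`.
The remaining indicator terms are nonnegative. -/
theorem log_radialFn_le (hn : n ≠ 0) {δ : ℝ} (hδ : 0 < δ) (hδn : √n * δ ≤ 1)
    (e : OrthonormalBasis (Fin n) ℝ (EuclideanSpace ℝ (Fin n))) {a : Fin n → ℝ}
    (ha : Monotone a) (ha0 : ∀ i, 0 < a i) {Q : Set (EuclideanSpace ℝ (Fin n))}
    (hQ : IsSymmBody Q) (hQa : ∀ x ∈ Q, ∀ i, |⟪e i, x⟫| ≤ √n * a i)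
    (u : Metric.sphere (0 : EuclideanSpace ℝ (Fin n)) 1) :
    Real.log (radialFn Q u) ≤ Real.log (√n / δ) + (logAxis hn a 0 + ∑ i ∈ Finset.range n,
      (slab e (i + 1) δ).indicator (fun _ => logAxis hn a (i + 1) - logAxis hn a i) u) := by
  have hn' : (0 : ℝ) < n := by positivity
  have hsn : 0 < √(n : ℝ) := Real.sqrt_pos.2 hn'
  have hu0 : (u : EuclideanSpace ℝ (Fin n)) ≠ 0 := ne_zero_of_mem_unit_sphere u
  have hmono := logAxis_mono hn ha ha0
  -- The condition `√n δ ≤ 1` ensures that not all coordinates of a unit vector are below `δ`.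
  have hex : ∃ m : ℕ, ∃ h : m < n, δ ≤ |⟪e ⟨m, h⟩, (u : EuclideanSpace ℝ (Fin n))⟫| := by
    obtain ⟨k, hk⟩ := exists_one_le_sqrt_mul_abs_inner hn e (norm_eq_of_mem_sphere u)
    exact ⟨k, k.2, le_of_mul_le_mul_left (hδn.trans hk) hsn⟩
  classical
  obtain ⟨hkn, hk⟩ := Nat.find_spec hex
  have hmin : ∀ j : Fin n, (j : ℕ) < Nat.find hex →
      |⟪e j, (u : EuclideanSpace ℝ (Fin n))⟫| < δ := fun j hj => by
    have := Nat.find_min hex hj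
    push Not at this
    exact this j.2
  set k := Nat.find hex
  have h1 : logAxis hn a k ≤ logAxis hn a 0 + ∑ i ∈ Finset.range n,
      (slab e (i + 1) δ).indicator (fun _ => logAxis hn a (i + 1) - logAxis hn a i) u := by
    have hnn : ∀ i, 0 ≤ (slab e (i + 1) δ).indicator
        (fun _ => logAxis hn a (i + 1) - logAxis hn a i) u := fun i =>
      Set.indicator_nonneg (fun _ _ => sub_nonneg.2 (hmono (Nat.le_succ i))) u
    rw [← sub_le_iff_le_add', ← Finset.sum_range_sub]
    refine le_trans (Finset.sum_le_sum fun i hi => ?_)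
      (Finset.sum_le_sum_of_subset_of_nonneg (Finset.range_mono hkn.le) fun i _ _ => hnn i)
    rw [Set.indicator_of_mem]
    exact fun j hj => hmin j (by have := Finset.mem_range.1 hi; omega)
  refine le_trans ?_ (add_le_add le_rfl h1)
  have h2 := hQa _ (hQ.radialFn_smul_mem hu0) ⟨k, hkn⟩
  have hρ := hQ.radialFn_pos hu0
  rw [inner_smul_right, abs_mul, abs_of_pos hρ] at h2
  rw [show logAxis hn a k = Real.log (a ⟨k, hkn⟩) from logAxis_val hn a ⟨k, hkn⟩,
    ← Real.log_mul (by positivity) (ha0 _).ne']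
  refine Real.log_le_log hρ ?_
  rw [div_mul_eq_mul_div, le_div_iff₀ hδ]
  exact (mul_le_mul_of_nonneg_left hk hρ.le).trans h2

theorem average_log_radialFn_le (hn : n ≠ 0) {δ : ℝ} (hδ : 0 < δ) (hδn : √n * δ ≤ 1)
    (e : OrthonormalBasis (Fin n) ℝ (EuclideanSpace ℝ (Fin n))) {a : Fin n → ℝ}
    (ha : Monotone a) (ha0 : ∀ i, 0 < a i) {Q : Set (EuclideanSpace ℝ (Fin n))}
    (hQ : IsSymmBody Q) (hQa : ∀ x ∈ Q, ∀ i, |⟪e i, x⟫| ≤ √n * a i)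
    (μ : Measure (Metric.sphere (0 : EuclideanSpace ℝ (Fin n)) 1)) [IsFiniteMeasure μ]
    (hμ : μ ≠ 0) :
    1 / μ.real Set.univ * ∫ u, Real.log (radialFn Q u) ∂μ ≤
      Real.log (√n / δ) + (logAxis hn a 0 + ∑ i ∈ Finset.range n,
        μ.real (slab e (i + 1) δ) / μ.real Set.univ *
          (logAxis hn a (i + 1) - logAxis hn a i)) := by
  have hm : 0 < μ.real Set.univ := by
    simpa [measureReal_def, ENNReal.toReal_pos_iff, pos_iff_ne_zero] using hμ
  have hind : ∀ i ∈ Finset.range n, Integrable ((slab e (i + 1) δ).indicator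
      (fun _ => logAxis hn a (i + 1) - logAxis hn a i)) μ := fun i _ =>
    (integrable_const _).indicator (measurableSet_slab e _ δ)
  have hsum := integrable_finsetSum _ hind
  have hadd : Integrable (fun u => logAxis hn a 0 + ∑ i ∈ Finset.range n,
      (slab e (i + 1) δ).indicator (fun _ => logAxis hn a (i + 1) - logAxis hn a i) u) μ :=
    (integrable_const _).add hsum
  have h1 := integral_mono (hQ.integrable_log_radialFn μ) ((integrable_const _).add hadd)
    (log_radialFn_le hn hδ hδn e ha ha0 hQ hQa)
  simp only [Pi.add_apply] at h1
  rw [integral_add (integrable_const _) hadd, integral_add (integrable_const _) hsum,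
    integral_finsetSum _ hind] at h1
  simp only [integral_const, integral_indicator_const _ (measurableSet_slab e _ δ),
    smul_eq_mul] at h1
  calc _ ≤ 1 / μ.real Set.univ * _ := mul_le_mul_of_nonneg_left h1 (by positivity)
    _ = _ := by
      rw [mul_add, mul_add, Finset.mul_sum]
      congr 1
      · field_simp
      · congr 1
        · field_simp
        · exact Finset.sum_congr rfl fun i _ => by ring

/-! ### Uniform bound over all orthonormal frames. -/

/-- The functional of every body that is equivalent to a box with axes along a basis in `s` is
controlled by the ratio of the shortest and the longest axis. -/
def HasUniformBound (hn : n ≠ 0) (q : ℝ)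
    (μ : Measure (Metric.sphere (0 : EuclideanSpace ℝ (Fin n)) 1))
    (s : Set (Fin n → EuclideanSpace ℝ (Fin n))) : Prop :=
  ∃ C ε : ℝ, 0 < ε ∧ ∀ (e : OrthonormalBasis (Fin n) ℝ (EuclideanSpace ℝ (Fin n)))
    (a : Fin n → ℝ) (Q : Set (EuclideanSpace ℝ (Fin n))), ⇑e ∈ s → Monotone a → (∀ i, 0 < a i) →
      IsSymmBody Q → (∀ x ∈ Q, ∀ i, |⟪e i, x⟫| ≤ √n * a i) →
      (∀ u i, a i * |⟪e i, u⟫| ≤ √n * supportFn Q u) →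
      setFunctional q μ Q ≤ C + ε * (logAxis hn a 0 - logAxis hn a n)

/-- Both terms are expressed in the increments of `log aᵢ`. The slab proportion in the radial term
is below `Wᵢ - ε` throughout a neighbourhood of `e`, so after adding the support term each increment
keeps coefficient at most `-ε`, and the increments telescope. -/
theorem exists_mem_nhds_hasUniformBound (hn : n ≠ 0) {q : ℝ} (hq : q ∈ Set.Ioc (0 : ℝ) n)
    (μ : Measure (Metric.sphere (0 : EuclideanSpace ℝ (Fin n)) 1)) [IsFiniteMeasure μ]
    (hμ : μ ≠ 0) {e : OrthonormalBasis (Fin n) ℝ (EuclideanSpace ℝ (Fin n))}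
    (hsub : SubspaceMassIneqWrt q μ e) :
    ∃ U ∈ 𝓝 (⇑e), HasUniformBound hn q μ U := by
  obtain ⟨W, hW0, hWn, hWmono, hWq, hWmass⟩ := exists_weights hq μ hsub
  have hq0 := hq.1
  have hW_sum : ∑ i : Fin n, (W i - W (i + 1)) = 1 := by
    rw [Fin.sum_univ_eq_sum_range (fun i => W i - W (i + 1)), Finset.sum_range_sub', hW0, hWn,
      sub_zero]
  obtain ⟨C, hC0, hC⟩ := exists_integral_supportFn_le hn hq0 (θ := fun i : Fin n => W i - W (i + 1))
    (fun i => sub_nonneg.2 (hWmono i i.2)) hW_sum (fun i hi => hWq i i.2 hi)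
  obtain ⟨ε, hεpos, hε⟩ : ∃ ε > 0, ∀ i ∈ Finset.range n, i ≠ 0 →
      massRatio μ (tailSpan e i) < W i - ε := by
    have : ∀ᶠ ε : ℝ in 𝓝[>] 0, ∀ i ∈ Finset.range n, i ≠ 0 →
        massRatio μ (tailSpan e i) < W i - ε := by
      rw [eventually_all_finset]
      intro i hi
      by_cases hi0 : i = 0
      · simp [hi0]
      · filter_upwards [Ioo_mem_nhdsGT (sub_pos.2 (hWmass i (Finset.mem_range.1 hi) hi0))]
          with ε hε _
        linarith [hε.2]
    obtain ⟨ε, h1, h2⟩ := (this.and self_mem_nhdsWithin).exists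
    exact ⟨ε, h2, h1⟩
  obtain ⟨δ, hδ, hδpos, hδn⟩ : ∃ δ : ℝ, (∀ i ∈ Finset.range n, i ≠ 0 →
      μ.real (slab e i (2 * δ)) / μ.real Set.univ < W i - ε) ∧ 0 < δ ∧ √n * δ ≤ 1 := by
    have h1 : ∀ᶠ δ in 𝓝[>] (0 : ℝ), ∀ i ∈ Finset.range n, i ≠ 0 →
        μ.real (slab e i δ) / μ.real Set.univ < W i - ε := by
      rw [eventually_all_finset]
      intro i hi
      by_cases hi0 : i = 0
      · simp [hi0]
      · filter_upwards [eventually_slab_lt μ hμ e i (hε i hi hi0)] with δ h _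
        exact h
    have hs : 0 < √(n : ℝ) := Real.sqrt_pos.2 (by positivity)
    obtain ⟨δ, h2, h3⟩ := (h1.and (Ioo_mem_nhdsGT (inv_pos.2 hs))).exists
    refine ⟨δ / 2, by rwa [mul_div_cancel₀ _ two_ne_zero], half_pos h3.1, ?_⟩
    have := mul_le_mul_of_nonneg_left h3.2.le hs.le
    rw [mul_inv_cancel₀ hs.ne'] at this
    nlinarith [mul_pos hs h3.1]
  -- `C + 1` replaces `C` because `C` is only known to be nonnegative and its logarithm is taken.
  refine ⟨Metric.ball e δ, Metric.ball_mem_nhds _ hδpos,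
    Real.log (√n / δ) + 1 / q * Real.log (C + 1), ε, hεpos, ?_⟩
  intro e' a Q he' ha ha0 hQ hQa hQh
  have hm : 0 < μ.real Set.univ := by
    simpa [measureReal_def, ENNReal.toReal_pos_iff, pos_iff_ne_zero] using hμ
  have hmono := logAxis_mono hn ha ha0
  have h1 := average_log_radialFn_le hn hδpos hδn e' ha ha0 hQ hQa μ hμ
  have hprod : 0 < ∏ i, a i ^ (-(q * (W i - W ((i : ℕ) + 1)))) :=
    Finset.prod_pos fun i _ => Real.rpow_pos_of_pos (ha0 i) _
  have h2 : 1 / q * Real.log (∫ u, supportFn Q u ^ (-q)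
      ∂(volume : Measure (EuclideanSpace ℝ (Fin n))).toSphere) ≤ 1 / q * Real.log (C + 1) -
        (logAxis hn a 0 + ∑ i ∈ Finset.range n,
          W (i + 1) * (logAxis hn a (i + 1) - logAxis hn a i)) := by
    have h3 : ∫ u, supportFn Q u ^ (-q)
        ∂(volume : Measure (EuclideanSpace ℝ (Fin n))).toSphere ≤
          (C + 1) * ∏ i, a i ^ (-(q * (W i - W ((i : ℕ) + 1)))) :=
      (hC e' a Q ha ha0 hQ hQh).trans
        (mul_le_mul_of_nonneg_right (by linarith) hprod.le)
    have h4 := Real.log_le_log (hQ.integral_supportFn_rpow_pos hn (-q)) h3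
    rw [Real.log_mul (by positivity) hprod.ne',
      Real.log_prod fun i _ => (Real.rpow_pos_of_pos (ha0 i) _).ne'] at h4
    have h5 : ∑ i : Fin n, Real.log (a i ^ (-(q * (W i - W ((i : ℕ) + 1))))) =
        -q * (logAxis hn a 0 + ∑ i ∈ Finset.range n,
          W (i + 1) * (logAxis hn a (i + 1) - logAxis hn a i)) := by
      have h6 := sum_sub_mul_eq W (logAxis hn a) n
      rw [hW0, hWn, one_mul, zero_mul, sub_zero] at h6
      rw [← h6, ← Fin.sum_univ_eq_sum_range (fun i => (W i - W (i + 1)) * logAxis hn a i),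
        Finset.mul_sum]
      refine Finset.sum_congr rfl fun i _ => ?_
      rw [Real.log_rpow (ha0 i), logAxis_val]
      ring
    rw [h5] at h4
    calc _ ≤ 1 / q * _ := mul_le_mul_of_nonneg_left h4 (by positivity)
      _ = _ := by field_simp; ring
  have h7 : ∑ i ∈ Finset.range n, μ.real (slab e' (i + 1) δ) / μ.real Set.univ *
      (logAxis hn a (i + 1) - logAxis hn a i) ≤ ∑ i ∈ Finset.range n,
        (W (i + 1) * (logAxis hn a (i + 1) - logAxis hn a i) -
          ε * (logAxis hn a (i + 1) - logAxis hn a i)) := by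
    refine Finset.sum_le_sum fun i hi => ?_
    rw [← sub_mul]
    rcases eq_or_ne (i + 1) n with hin | hin
    -- The last increment is zero by the constant continuation of `logAxis`, so no mass bound is
    -- needed at index `n`, where `W` vanishes.
    · have : logAxis hn a (i + 1) = logAxis hn a i := by
        unfold logAxis
        congr 2
        exact Fin.ext (by simp; omega)
      rw [this, sub_self, mul_zero, mul_zero]
    · refine mul_le_mul_of_nonneg_right ?_ (sub_nonneg.2 (hmono (Nat.le_succ i)))
      have hi' := Finset.mem_range.1 hi
      refine le_trans ?_ (hδ (i + 1) (Finset.mem_range.2 (by omega)) (Nat.succ_ne_zero i)).le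
      exact div_le_div_of_nonneg_right
        (measureReal_mono (slab_subset_of_dist_le (Metric.mem_ball.1 he').le _)) hm.le
  rw [Finset.sum_sub_distrib, ← Finset.mul_sum, Finset.sum_range_sub] at h7
  unfold setFunctional
  linarith

theorem isCompact_orthonormal :
    IsCompact {p : Fin n → EuclideanSpace ℝ (Fin n) | Orthonormal ℝ p} := by
  refine Metric.isCompact_of_isClosed_isBounded ?_ ?_
  · simp only [orthonormal_iff_ite]
    have : {p : Fin n → EuclideanSpace ℝ (Fin n) | ∀ i j, ⟪p i, p j⟫ = if i = j then (1 : ℝ) else 0}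
        = ⋂ i, ⋂ j, {p | ⟪p i, p j⟫ = if i = j then (1 : ℝ) else 0} := by
      ext; simp
    rw [this]
    exact isClosed_iInter fun i => isClosed_iInter fun j =>
      isClosed_eq (by fun_prop) continuous_const
  · refine (Metric.isBounded_closedBall (x := 0) (r := 1)).subset fun p hp => ?_
    rw [mem_closedBall_zero_iff]
    exact (pi_norm_le_iff_of_nonneg zero_le_one).2 fun i => (hp.1 i).le

/-- Local bounds pass to finite unions, since the factor multiplying `ε` is nonpositive and the
smaller `ε` is therefore the weaker bound. -/
theorem hasUniformBound_orthonormal (hn : n ≠ 0) {q : ℝ} (hq : q ∈ Set.Ioc (0 : ℝ) n)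
    (μ : Measure (Metric.sphere (0 : EuclideanSpace ℝ (Fin n)) 1)) [IsFiniteMeasure μ]
    (hμ : μ ≠ 0) (hsub : SubspaceMassIneq q μ) :
    HasUniformBound hn q μ {p | Orthonormal ℝ p} := by
  refine isCompact_orthonormal.induction_on ?_ ?_ ?_ ?_
  · exact ⟨0, 1, one_pos, fun e a Q h => h.elim⟩
  · rintro s t hst ⟨C, ε, hε, h⟩
    exact ⟨C, ε, hε, fun e a Q he => h e a Q (hst he)⟩
  · rintro s t ⟨C, ε, hε, h⟩ ⟨C', ε', hε', h'⟩
    refine ⟨max C C', min ε ε', lt_min hε hε', fun e a Q he ha ha0 hQ h1 h2 => ?_⟩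
    have hle : logAxis hn a 0 - logAxis hn a n ≤ 0 :=
      sub_nonpos.2 (logAxis_mono hn ha ha0 (Nat.zero_le n))
    rcases he with he | he
    · exact (h e a Q he ha ha0 hQ h1 h2).trans (add_le_add (le_max_left _ _)
        (mul_le_mul_of_nonpos_right (min_le_left _ _) hle))
    · exact (h' e a Q he ha ha0 hQ h1 h2).trans (add_le_add (le_max_right _ _)
        (mul_le_mul_of_nonpos_right (min_le_right _ _) hle))
  · intro p hp
    have hspan : ⊤ ≤ Submodule.span ℝ (Set.range p) :=
      (hp.linearIndependent.span_eq_top_of_card_eq_finrank' (by simp)).ge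
    obtain ⟨U, hU, h⟩ := exists_mem_nhds_hasUniformBound hn hq μ hμ
      (hsub (OrthonormalBasis.mk hp hspan))
    rw [OrthonormalBasis.coe_mk] at hU
    exact ⟨U, mem_nhdsWithin_of_mem_nhds hU, h⟩

/-! ### Rescaling and existence of the maximizer. -/

theorem norm_le_of_abs_inner_le (e : OrthonormalBasis (Fin n) ℝ (EuclideanSpace ℝ (Fin n)))
    {x : EuclideanSpace ℝ (Fin n)} {c : ℝ} (hc : 0 ≤ c) (h : ∀ i, |⟪e i, x⟫| ≤ √n * c) :
    ‖x‖ ≤ n * c := by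
  have hn : (0 : ℝ) ≤ n := Nat.cast_nonneg n
  refine abs_le_of_sq_le_sq' ?_ (by positivity) |>.2
  rw [← e.sum_sq_norm_inner_right x]
  calc ∑ i, ‖⟪e i, x⟫‖ ^ 2 ≤ ∑ _i : Fin n, (√n * c) ^ 2 :=
        Finset.sum_le_sum fun i _ => pow_le_pow_left₀ (norm_nonneg _) (h i) 2
    _ = (n * c) ^ 2 := by simp [mul_pow, Real.sq_sqrt hn]; ring

/-- Among the symmetric bodies whose functional is bounded below by `F`, those that are rescaled to
have longest axis `1` contain a fixed ball and lie in a fixed ball. -/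
theorem exists_rescaling (hn : n ≠ 0) {q : ℝ} (hq : q ∈ Set.Ioc (0 : ℝ) n)
    (μ : Measure (Metric.sphere (0 : EuclideanSpace ℝ (Fin n)) 1)) [IsFiniteMeasure μ]
    (hμ : μ ≠ 0) (hsub : SubspaceMassIneq q μ) (F : ℝ) :
    ∃ r > 0, ∀ Q : Set (EuclideanSpace ℝ (Fin n)), IsSymmBody Q → F ≤ setFunctional q μ Q →
      ∃ t : ℝ, 0 < t ∧ Metric.closedBall 0 r ⊆ t • Q ∧ t • Q ⊆ Metric.closedBall 0 n := by
  obtain ⟨C, ε, hε, hbound⟩ := hasUniformBound_orthonormal hn hq μ hμ hsub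
  have hn' : (0 : ℝ) < n := by positivity
  refine ⟨Real.exp ((F - C) / ε) / n, by positivity, fun Q hQ hF => ?_⟩
  obtain ⟨e, a, ha, ha0, hQa, hQh⟩ := hQ.exists_box
  have h1 := hF.trans (hbound e a Q e.orthonormal ha ha0 hQ hQa hQh)
  set a₀ := a ⟨min 0 (n - 1), by omega⟩ with ha₀
  set a₁ := a ⟨min n (n - 1), by omega⟩ with ha₁
  have ha₀pos : 0 < a₀ := ha0 _
  have ha₁pos : 0 < a₁ := ha0 _
  have hmin : ∀ i, a₀ ≤ a i := fun i => ha (Fin.mk_le_of_le_val (by simp))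
  have hmax : ∀ i, a i ≤ a₁ := fun i => ha (Fin.le_def.2 (by simp; omega))
  -- The uniform bound reads `F ≤ C + ε log (a₀ / a₁)`, with `a₀` the shortest and `a₁` the longest
  -- axis.
  have hratio : Real.exp ((F - C) / ε) ≤ a₁⁻¹ * a₀ := by
    rw [← Real.le_log_iff_exp_le (by positivity), Real.log_mul (inv_pos.2 ha₁pos).ne' ha₀pos.ne',
      Real.log_inv, div_le_iff₀ hε]
    unfold logAxis at h1
    linarith
  have hball : Metric.closedBall 0 (a₀ / n) ⊆ Q := by
    refine hQ.closedBall_subset fun u => ?_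
    have hsn : 0 < √(n : ℝ) := Real.sqrt_pos.2 hn'
    have h2 : ∀ i, |⟪e i, u⟫| ≤ √n * (supportFn Q u / a₀) := fun i => by
      rw [mul_div_assoc', le_div_iff₀ ha₀pos, mul_comm]
      exact (mul_le_mul_of_nonneg_right (hmin i) (abs_nonneg _)).trans (hQh u i)
    have hsupp : 0 ≤ supportFn Q u :=
      (abs_nonneg _).trans (hQ.abs_inner_le_supportFn (x := u) hQ.zero_mem)
    have h3 := norm_le_of_abs_inner_le e (div_nonneg hsupp ha₀pos.le) h2
    calc a₀ / n * ‖u‖ ≤ a₀ / n * (n * (supportFn Q u / a₀)) := by gcongr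
      _ = supportFn Q u := by field_simp
  refine ⟨a₁⁻¹, inv_pos.2 ha₁pos, fun x hx => ?_, ?_⟩
  · rw [Set.mem_smul_set_iff_inv_smul_mem₀ (inv_pos.2 ha₁pos).ne', inv_inv]
    apply hball
    rw [mem_closedBall_zero_iff] at hx ⊢
    rw [norm_smul, Real.norm_of_nonneg ha₁pos.le]
    calc a₁ * ‖x‖ ≤ a₁ * (a₁⁻¹ * a₀ / n) := by
          gcongr
          exact hx.trans (by gcongr)
      _ = a₀ / n := by field_simp
  · rintro _ ⟨x, hx, rfl⟩
    rw [mem_closedBall_zero_iff]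
    dsimp only
    rw [norm_smul, Real.norm_of_nonneg (inv_pos.2 ha₁pos).le, inv_mul_le_iff₀ ha₁pos, mul_comm]
    exact norm_le_of_abs_inner_le e ha₁pos.le fun i =>
      (hQa x hx i).trans (mul_le_mul_of_nonneg_left (hmax i) (Real.sqrt_nonneg _))

theorem lemma6p5 (n : ℕ) (q : ℝ) (hq : q ∈ Set.Ioc (0 : ℝ) n)
    (μ : Measure (Metric.sphere (0 : EuclideanSpace ℝ (Fin n)) 1)) [IsFiniteMeasure μ]
    (hμ : μ ≠ 0) (hsub : SubspaceMassIneq q μ) :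
    ∃ K ∈ symmConvexBodies n,
      IsLUB (dualMinkowskiFunctional q μ '' symmConvexBodies n) (dualMinkowskiFunctional q μ K) := by
  have hn : n ≠ 0 := by
    rintro rfl
    exact lt_irrefl _ (hq.1.trans_le (by simpa using hq.2))
  have hn1 : (1 : ℝ) ≤ n := by exact_mod_cast Nat.one_le_iff_ne_zero.2 hn
  set B := Metric.closedBall (0 : EuclideanSpace ℝ (Fin n)) 1
  obtain ⟨r, hr, hresc⟩ := exists_rescaling hn hq μ hμ hsub (setFunctional q μ B)
  -- The inner radius is capped at `1` so that the unit ball is itself a competitor; bodies with a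
  -- smaller value than the ball need no rescaling.
  obtain ⟨M, hM, hmax⟩ := exists_maximizer_between hn (lt_min hr one_pos)
    ((min_le_right r 1).trans hn1) hq.1 μ hμ
  have hB : setFunctional q μ B ≤ setFunctional q μ M :=
    hmax B (IsSymmBody.closedBall one_pos) (Metric.closedBall_subset_closedBall (min_le_right _ _))
      (Metric.closedBall_subset_closedBall hn1)
  have hle : ∀ Q : Set (EuclideanSpace ℝ (Fin n)), IsSymmBody Q →
      setFunctional q μ Q ≤ setFunctional q μ M := fun Q hQ => by
    rcases le_or_gt (setFunctional q μ B) (setFunctional q μ Q) with h | h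
    · obtain ⟨t, ht, h1, h2⟩ := hresc Q hQ h
      have h3 : Q = t⁻¹ • t • Q := by rw [smul_smul, inv_mul_cancel₀ ht.ne', one_smul]
      -- Equal inner and outer factors: the two logarithms cancel, which is dilation invariance.
      have h4 := setFunctional_le_add_log hn hQ (hQ.smul ht) (inv_pos.2 ht) (inv_pos.2 ht)
        h3.ge h3.le hq.1 μ hμ
      rw [add_sub_cancel_right] at h4
      exact h4.trans (hmax _ (hQ.smul ht)
        ((Metric.closedBall_subset_closedBall (min_le_left _ _)).trans h1) h2)
    · exact h.le.trans hB
  obtain ⟨K, hK, rfl⟩ := hM.exists_convexBody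
  refine ⟨K, hK, ?_, fun b hb => hb ⟨K, hK, rfl⟩⟩
  rintro _ ⟨Q, hQ, rfl⟩
  exact hle _ (IsSymmBody.of_mem_symmConvexBodies hQ)
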